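/- All graphs are finite and simple. For a graph $G$ with $n$ vertices and Laplacian matrix $L(G)$, the Laplacian coefficients $c_0(G),\dots,c_n(G)$ are defined by $\det(\lambda I_n-L(G))=\sum_{k=0}^{n}(-1)^k c_k(G)\lambda^{n-k}$. For two graphs $G,H$ of the same order $n$, write $G\preceq H$ if $c_k(G)\le c_k(H)$ for all $0\le k\le n$; equality holds in $G\preceq H$ if $c_k(G)=c_k(H)$ for all $0\le k\le n$. Let $\mathcal{U}_{n,l}^g$ be the set of unicyclic graphs (connected graphs with as many edges as vertices) with $n$ vertices, $l$ leaves (vertices of degree one) and girth $g\ge 3$. For trees $T_1,\dots,T_g$ with roots, let $C_{T_1,\dots,T_g}$ be the graph obtained from the cycle $C_g=u_1u_2\cdots u_g$ by identifying $u_i$ with the root of $T_i$ for $i=1,\dots,g$. The balanced starlike tree $BST_{m,l}$ is the tree of order $m$ obtained from $l$ paths, each of order $\lfloor\frac{m-1}{l}\rfloor+1$ or $\lceil\frac{m-1}{l}\rceil+1$, by identifying one end of each of them; the identified vertex is its center. Let $C_{T_1,\dots,T_g}\in\mathcal{U}_{n,l}^g$ be such that $|V(T_i)|=1$ for $i=2,\dots,g$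 and the degree of $u_1$ in $C_{T_1,\dots,T_g}$ satisfies $d(u_1)>3$. Let $B_1$ be $BST_{n-g+1,l}$ rooted at its center and let $|V(B_i)|=1$ for $i=2,\dots,g$. Then $$C_{B_1,\dots,B_g}\preceq C_{T_1,\dots,T_g},$$ and equality holds if and only if $C_{B_1,\dots,B_g}\cong C_{T_1,\dots,T_g}$. -/

import Mathlib

open Classical in
/-- The Laplacian coefficient `c_k(G)`, defined by
`det (λ I - L(G)) = ∑_{k=0}^{n} (-1)^k c_k(G) λ^{n-k}` with `n = |V(G)|` (used for `k ≤ n`). -/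
noncomputable def laplacianCoeff {V : Type*} [Fintype V] (G : SimpleGraph V) (k : ℕ) : ℤ :=
  (-1) ^ k * (G.lapMatrix ℤ).charpoly.coeff (Fintype.card V - k)

/-- `G ⪯ H`: the graphs have the same order `n` and `c_k(G) ≤ c_k(H)` for all `0 ≤ k ≤ n`. -/
def LaplacianLE {V W : Type*} [Fintype V] [Fintype W]
    (G : SimpleGraph V) (H : SimpleGraph W) : Prop :=
  Fintype.card V = Fintype.card W ∧
    ∀ k ≤ Fintype.card V, laplacianCoeff G k ≤ laplacianCoeff H k

/-- `G` and `H` have the same order and all their Laplacian coefficients coincide. -/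
def LaplacianEq {V W : Type*} [Fintype V] [Fintype W]
    (G : SimpleGraph V) (H : SimpleGraph W) : Prop :=
  Fintype.card V = Fintype.card W ∧
    ∀ k ≤ Fintype.card V, laplacianCoeff G k = laplacianCoeff H k

open Classical in
/-- The degree of a vertex of a finite graph. -/
noncomputable def vertexDegree {V : Type*} [Fintype V] (G : SimpleGraph V) (v : V) : ℕ :=
  G.degree v

/-- The number of leaves, i.e. of vertices of degree one. -/
noncomputable def leafCount {V : Type*} [Fintype V] (G : SimpleGraph V) : ℕ :=
  {v : V | vertexDegree G v = 1}.ncard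

/-- `G` is a unicyclic graph (connected, with as many edges as vertices) with `n` vertices,
`l` leaves and girth `g`. -/
structure IsUnicyclic {V : Type*} [Fintype V] (n l g : ℕ) (G : SimpleGraph V) : Prop where
  connected : G.Connected
  edges : G.edgeSet.ncard = Fintype.card V
  order : Fintype.card V = n
  leaves : leafCount G = l
  girth : G.girth = g

universe u

/-- A finite simple graph with a distinguished vertex. -/
structure RootedGraph where
  /-- the vertex type -/
  V : Type u
  [fin : Fintype V]
  /-- the underlying graph -/
  graph : SimpleGraph V
  /-- the distinguished vertex -/
  root : V

attribute [instance] RootedGraph.fin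

/-- The graph `C_{T_1, …, T_g}`: the vertex `u_i` of the cycle of order `g` is identified with
the root of `T i` (indices start at `0`). Two vertices are adjacent iff they are adjacent in one
of the `T i`, or are the roots of `T i` and `T j` with `i`, `j` adjacent in the cycle. -/
def cycleAttach {g : ℕ} (T : Fin g → RootedGraph.{u}) : SimpleGraph (Σ i, (T i).V) where
  Adj x y :=
    (∃ (i : Fin g) (a b : (T i).V), (T i).graph.Adj a b ∧ x = ⟨i, a⟩ ∧ y = ⟨i, b⟩) ∨
    ∃ i j : Fin g, (SimpleGraph.cycleGraph g).Adj i j ∧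
      x = ⟨i, (T i).root⟩ ∧ y = ⟨j, (T j).root⟩
  symm := ⟨by
    rintro x y (⟨i, a, b, h, hx, hy⟩ | ⟨i, j, h, hx, hy⟩)
    · exact Or.inl ⟨i, b, a, h.symm, hy, hx⟩
    · exact Or.inr ⟨j, i, h.symm, hy, hx⟩⟩
  loopless := ⟨by
    rintro x (⟨i, a, b, h, rfl, hy⟩ | ⟨i, j, h, rfl, hy⟩)
    · obtain rfl : a = b := by simpa using hy
      exact h.ne rfl
    · exact h.ne (congrArg Sigma.fst hy)⟩

/-- Number of vertices other than the center on the `j`-th path of `BST_{m,l}`: `m - 1` is split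
into `l` parts, each `⌊(m-1)/l⌋` or `⌈(m-1)/l⌉`; the first `(m-1) mod l` are the larger ones. -/
def legLength (m l j : ℕ) : ℕ := (m - 1) / l + if j < (m - 1) % l then 1 else 0

/-- The balanced starlike tree `BST_{m,l}` rooted at its center. The center is `none`;
`some ⟨j, a⟩` is the vertex at distance `a + 1` from the center on the `j`-th path. -/
def balancedStarlike (m l : ℕ) : RootedGraph.{0} where
  V := Option (Σ j : Fin l, Fin (legLength m l j))
  graph := SimpleGraph.fromRel fun x y => match x, y with
    | none, some ⟨_, b⟩ => (b : ℕ) = 0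
    | some ⟨i, a⟩, some ⟨j, b⟩ => i = j ∧ (a : ℕ) + 1 = b
    | _, _ => False
  root := none

/-- The one-vertex rooted graph. -/
def singleVertex : RootedGraph.{0} where
  V := Unit
  graph := ⊥
  root := ()

/-- The family `B_1, …, B_g`: `B_1` is `BST_{n-g+1,l}` rooted at its center, and `B_2, …, B_g`
are single vertices. -/
def balancedFamily (n l g : ℕ) : Fin g → RootedGraph.{0} :=
  fun i => if (i : ℕ) = 0 then balancedStarlike (n - g + 1) l else singleVertex

/-! Since `lapDet`, that is det(X + L), is the characteristic polynomial of -L, its coefficient at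
X^(n-k) is c_k. The relation ⪯ is therefore the coefficientwise order on ℤ[X], which is an ordered
ring but neither a field nor totally ordered.

Cutting C_{T_1,…,T_g} at u_1 gives det(X + L) = P·D + Q·E (`lapDet_attach`). Here P = det(X +
L(T_1)), Q is the principal minor at the root, and D, E depend only on the rest of the cycle. Both D
and E are nonnegative, by a determinant criterion of M-matrix type, and E ≠ 0. So it suffices that
the balanced starlike tree minimizes P and Q simultaneously, with equality in Q only for itself;
equality in the theorem forces equality in Q because E cancels (`lapDet_attach_le`).

A rooted tree is encoded by the dual number Q + Rε with P = R + XQ. Identifying roots is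
multiplication, and hanging the tree from a new root is the linear map `plant`, of determinant 1.
The minimization then has three ingredients.

For P, `pairTotal_transfer_le` moves a subtree along a path towards the end with larger R/Q, which
does not increase P. Since P does not depend on the root, repeated transfers turn any tree with at
least two root branches into a starlike tree with the same numbers of edges and leaves
(`exists_pairTotal_le`); this is where d(u_1) > 3 enters.

For Q, moving side branches up to the root decreases the minor, strictly if anything moves
(`exists_fst_le`).

For both, evening out two legs whose lengths differ by at least 2 does not increase P and strictly
decreases Q (`exists_balanced`). The starlike trees found for P and for Q may differ, but a balanced
multiset of legs is determined by its size and sum, so both end at the same tree. -/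

open DualNumber Polynomial

universe v₁ v₂ v₃ v₄

/-! ### Dual-number calculus of rooted trees and transfer of subtrees -/

section RootedPairs

variable {A : Type*} [CommRing A] (x : A)

/-- For the pair `z = Q + R ε` of a rooted graph, `Q` being the principal minor of `x + L` at the
root and `R / Q` the excess of the Schur complement over `x`, this is `det (x + L)`. -/
def pairTotal (z : A[ε]) : A := z.snd + x * z.fst

/-- The pair of the rooted graph obtained by joining a new root to the old one. -/
def plant (z : A[ε]) : A[ε] :=
  TrivSqZeroExt.inl (z.fst + pairTotal x z) + TrivSqZeroExt.inr (pairTotal x z)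

/-- The pair of a path with `a` edges rooted at an end. -/
def leg (a : ℕ) : A[ε] := (plant x)^[a] 1

/-- The pair of a starlike tree with prescribed leg lengths, rooted at its center. -/
def starPair (L : Multiset ℕ) : A[ε] := (L.map (leg x)).prod

@[simp] theorem fst_plant (z : A[ε]) : (plant x z).fst = z.fst + pairTotal x z := by
  simp [plant]

@[simp] theorem snd_plant (z : A[ε]) : (plant x z).snd = pairTotal x z := by
  simp [plant]

theorem pairTotal_mul (y z : A[ε]) :
    pairTotal x (y * z) = y.fst * pairTotal x z + y.snd * z.fst := by
  simp only [pairTotal, TrivSqZeroExt.fst_mul, DualNumber.snd_mul]; ring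

/-- Two rooted graphs joined by an edge may be rooted at either end of it, and the determinant does
not see the root. All later re-rooting rests on this. -/
theorem pairTotal_mul_plant (y z : A[ε]) :
    pairTotal x (y * plant x z) = pairTotal x (plant x y * z) := by
  simp only [pairTotal_mul, fst_plant, snd_plant]
  simp only [pairTotal, fst_plant, snd_plant]
  ring

theorem pairTotal_mul_plant_iterate (d : ℕ) (y z : A[ε]) :
    pairTotal x (y * (plant x)^[d] z) = pairTotal x ((plant x)^[d] y * z) := by
  induction d generalizing y z with
  | zero => rfl
  | succ d ih =>
    rw [Function.iterate_succ_apply', Function.iterate_succ_apply, pairTotal_mul_plant, ih]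

@[simp] theorem leg_zero : leg x 0 = 1 := rfl

theorem leg_succ (a : ℕ) : leg x (a + 1) = plant x (leg x a) :=
  Function.iterate_succ_apply' _ _ _

theorem plant_iterate_leg (d a : ℕ) : (plant x)^[d] (leg x a) = leg x (d + a) :=
  (Function.iterate_add_apply _ _ _ _).symm

@[simp] theorem starPair_zero : starPair x 0 = 1 := by simp [starPair]

@[simp] theorem starPair_cons (a : ℕ) (L : Multiset ℕ) :
    starPair x (a ::ₘ L) = leg x a * starPair x L := by simp [starPair]

@[simp] theorem starPair_add (L M : Multiset ℕ) :
    starPair x (L + M) = starPair x L * starPair x M := by simp [starPair]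

/-- An identity of d'Ocagne type: `plant` acts on (fst, snd) by a matrix of determinant 1, so the
difference of the two products is independent of `b` and can be read off at `b = 0`. -/
theorem fst_leg_mul_fst_leg (b d : ℕ) :
    (leg x (b + d + 2)).fst * (leg x b).fst =
      (leg x (b + d + 1)).fst * (leg x (b + 1)).fst + (leg x (d + 1)).snd := by
  induction b with
  | zero =>
    simp only [zero_add, leg_succ, leg_zero, fst_plant, snd_plant, pairTotal,
      TrivSqZeroExt.fst_one, TrivSqZeroExt.snd_one]
    ring
  | succ b ih =>
    have e1 : b + 1 + d + 2 = b + d + 1 + 1 + 1 := by ring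
    have e2 : b + 1 + d + 1 = b + d + 1 + 1 := by ring
    rw [e1, e2]
    rw [show b + d + 2 = b + d + 1 + 1 by ring] at ih
    simp only [leg_succ, fst_plant, snd_plant, pairTotal] at ih ⊢
    linear_combination ih

theorem pairTotal_leg_shift (a b : ℕ) :
    pairTotal x (leg x (a + 1) * leg x b) = pairTotal x (leg x a * leg x (b + 1)) := by
  rw [leg_succ, leg_succ, pairTotal_mul_plant]

variable [PartialOrder A] [IsOrderedRing A]

/-- Both components are nonnegative. -/
def PairNonneg (z : A[ε]) : Prop := 0 ≤ z.fst ∧ 0 ≤ z.snd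

/-- `b.snd / b.fst ≤ a.snd / a.fst` after clearing denominators. -/
def PairDom (b a : A[ε]) : Prop := a.fst * b.snd ≤ b.fst * a.snd

theorem PairNonneg.one : PairNonneg (1 : A[ε]) := by simp [PairNonneg]

theorem PairNonneg.mul {y z : A[ε]} (hy : PairNonneg y) (hz : PairNonneg z) :
    PairNonneg (y * z) := by
  refine ⟨?_, ?_⟩
  · simpa using mul_nonneg hy.1 hz.1
  · rw [DualNumber.snd_mul]
    exact add_nonneg (mul_nonneg hy.1 hz.2) (mul_nonneg hy.2 hz.1)

variable {x}

theorem PairNonneg.pairTotal (hx : 0 ≤ x) {z : A[ε]} (hz : PairNonneg z) : 0 ≤ pairTotal x z :=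
  add_nonneg hz.2 (mul_nonneg hx hz.1)

theorem PairNonneg.plant (hx : 0 ≤ x) {z : A[ε]} (hz : PairNonneg z) :
    PairNonneg (plant x z) := by
  have := hz.pairTotal hx
  exact ⟨by simpa using add_nonneg hz.1 this, by simpa using this⟩

theorem PairNonneg.plant_iterate (hx : 0 ≤ x) (d : ℕ) {z : A[ε]} (hz : PairNonneg z) :
    PairNonneg ((_root_.plant x)^[d] z) := by
  induction d with
  | zero => exact hz
  | succ d ih => rw [Function.iterate_succ_apply']; exact ih.plant hx

theorem pairNonneg_leg (hx : 0 ≤ x) (a : ℕ) : PairNonneg (leg x a) :=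
  PairNonneg.one.plant_iterate hx a

theorem pairNonneg_starPair (hx : 0 ≤ x) (L : Multiset ℕ) : PairNonneg (starPair x L) := by
  induction L using Multiset.induction with
  | empty => simpa using PairNonneg.one
  | cons a L ih => simpa using (pairNonneg_leg hx a).mul ih

theorem fst_le_fst_plant (hx : 0 ≤ x) {z : A[ε]} (hz : PairNonneg z) :
    z.fst ≤ (plant x z).fst := by
  simpa using hz.pairTotal hx

theorem one_le_fst_leg (hx : 0 ≤ x) (a : ℕ) : 1 ≤ (leg x a).fst := by
  induction a with
  | zero => simp
  | succ a ih => rw [leg_succ]; exact ih.trans (fst_le_fst_plant hx (pairNonneg_leg hx a))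

theorem one_le_fst_starPair (hx : 0 ≤ x) (L : Multiset ℕ) : 1 ≤ (starPair x L).fst := by
  induction L using Multiset.induction with
  | empty => simp
  | cons a L ih => simpa using one_le_mul_of_one_le_of_one_le (one_le_fst_leg hx a) ih

/-- The ratios snd / fst add under multiplication, so extra branches at the root only help
domination. -/
theorem PairDom.mul_right {b a z : A[ε]} (h : PairDom b a) (hb : PairNonneg b)
    (ha : PairNonneg a) (hz : PairNonneg z) : PairDom b (a * z) := by
  have h1 := mul_le_mul_of_nonneg_right h hz.1
  have h2 := mul_nonneg (mul_nonneg hb.1 ha.1) hz.2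
  unfold PairDom
  rw [DualNumber.snd_mul, TrivSqZeroExt.fst_mul]
  rw [← sub_nonneg] at h1 ⊢
  convert add_nonneg h1 h2 using 1
  ring

theorem PairDom.mul_left {b a z : A[ε]} (h : PairDom b a) (hb : PairNonneg b)
    (ha : PairNonneg a) (hz : PairNonneg z) : PairDom b (z * a) := by
  rw [mul_comm]; exact h.mul_right hb ha hz

/-- The difference of the two sides is a 2×2 determinant, and `plant` has determinant 1, so it is
unchanged. -/
theorem PairDom.plant {b a : A[ε]} (h : PairDom b a) : PairDom (plant x b) (plant x a) := by
  unfold PairDom at h ⊢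
  simp only [fst_plant, snd_plant, pairTotal]
  rw [← sub_nonneg] at h ⊢
  convert h using 1
  ring

omit [IsOrderedRing A] in
theorem PairDom.one_left {a : A[ε]} (ha : PairNonneg a) : PairDom 1 a := by
  simpa [PairDom] using ha.2

/-- One planting of `z` is matched by removing one edge of the leg, which is why the hypothesis is
needed for all shorter legs as well. -/
theorem pairDom_plant_iterate (hx : 0 ≤ x) {c : ℕ} {z : A[ε]} (hz : PairNonneg z)
    (h : ∀ b ≤ c, PairDom (leg x b) z) (e : ℕ) :
    ∀ b ≤ c, PairDom (leg x b) ((plant x)^[e] z) := by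
  induction e with
  | zero => exact h
  | succ e ih =>
    intro b hb
    rw [Function.iterate_succ_apply']
    cases b with
    | zero => exact PairDom.one_left ((hz.plant_iterate hx e).plant hx)
    | succ b => rw [leg_succ]; exact (ih b (by omega)).plant

theorem pairDom_leg (hx : 0 ≤ x) {b c : ℕ} (h : b ≤ c) : PairDom (leg x b) (leg x c) := by
  induction c generalizing b with
  | zero =>
    obtain rfl : b = 0 := by omega
    exact PairDom.one_left PairNonneg.one
  | succ c ih =>
    cases b with
    | zero => exact PairDom.one_left (pairNonneg_leg hx _)
    | succ b => rw [leg_succ, leg_succ]; exact (ih (by omega)).plant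

theorem pairDom_starPair (hx : 0 ≤ x) {b c : ℕ} {M : Multiset ℕ} (h : b ≤ c) (hc : c ∈ M) :
    PairDom (leg x b) (starPair x M) := by
  obtain ⟨M, rfl⟩ := Multiset.exists_cons_of_mem hc
  rw [starPair_cons]
  exact (pairDom_leg hx h).mul_right (pairNonneg_leg hx _) (pairNonneg_leg hx _)
    (pairNonneg_starPair hx _)

/-- The coefficients depend only on `d`, so minors seen through the same path can be compared; `1 ≤
β` for `0 < d` supplies the strictness in the uniqueness argument. -/
theorem exists_fst_plant_iterate (hx : 0 ≤ x) (d : ℕ) :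
    ∃ α β : A, 1 ≤ α ∧ 0 ≤ β ∧ (0 < d → 1 ≤ β) ∧
      ∀ z : A[ε], ((plant x)^[d] z).fst = α * z.fst + β * z.snd := by
  induction d with
  | zero => exact ⟨1, 0, le_rfl, le_rfl, by simp, by simp⟩
  | succ d ih =>
    obtain ⟨α, β, hα, hβ, -, h⟩ := ih
    have hα0 : 0 ≤ α := zero_le_one.trans hα
    refine ⟨α * (1 + x) + β * x, α + β, ?_, add_nonneg hα0 hβ,
      fun _ => le_add_of_le_of_nonneg hα hβ, ?_⟩
    · refine le_add_of_le_of_nonneg ?_ (mul_nonneg hβ hx)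
      exact one_le_mul_of_one_le_of_one_le hα (le_add_of_nonneg_right hx)
    · intro z
      rw [Function.iterate_succ_apply, h, fst_plant, snd_plant, pairTotal]
      ring

/-- With `z` split off, the total is `z.fst` times the total of the remaining tree plus `z.snd`
times its minor at the attachment vertex. The first term is the same at both ends of the path; the
two minors differ by β times the quantity that `PairDom b a` makes nonnegative. -/
theorem pairTotal_transfer_le (hx : 0 ≤ x) (d : ℕ) {a b z : A[ε]} (h : PairDom b a)
    (hz : PairNonneg z) :
    pairTotal x (z * (a * (plant x)^[d] b)) ≤ pairTotal x (a * (plant x)^[d] (b * z)) := by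
  obtain ⟨α, β, -, hβ, -, hf⟩ := exists_fst_plant_iterate hx d
  rw [pairTotal_mul_plant_iterate, mul_comm b z, mul_left_comm _ z b, pairTotal_mul x z,
    pairTotal_mul x z, pairTotal_mul_plant_iterate]
  gcongr
  · exact hz.2
  · rw [TrivSqZeroExt.fst_mul, TrivSqZeroExt.fst_mul, hf, hf]
    have := mul_le_mul_of_nonneg_left h hβ
    rw [← sub_nonneg] at this ⊢
    convert this using 1
    ring

/-- A branch ending in a starlike tree can be dissolved into legs at a vertex carrying legs. -/
theorem exists_merge_broom (hx : 0 ≤ x) {h : A[ε]} (hh : PairNonneg h) {M L : Multiset ℕ} {d : ℕ}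
    (hM : M ≠ 0) (hd : 0 < d) (hMpos : ∀ a ∈ M, 0 < a) (hLpos : ∀ a ∈ L, 0 < a)
    (hL : L = 0 ∨ 2 ≤ L.card) :
    ∃ N : Multiset ℕ, N.card = M.card + max 1 L.card ∧ N.sum = M.sum + d + L.sum ∧
      (∀ a ∈ N, 0 < a) ∧
      pairTotal x (h * starPair x N) ≤
        pairTotal x (h * starPair x M * (plant x)^[d] (starPair x L)) := by
  rcases hL with rfl | hL
  · refine ⟨d ::ₘ M, by simp, by simp [add_comm], by simpa using ⟨hd, hMpos⟩, le_of_eq ?_⟩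
    rw [starPair_cons, starPair_zero, show (plant x)^[d] 1 = leg x d from rfl]
    congr 1; ring
  obtain ⟨a, ha⟩ := Multiset.exists_mem_of_ne_zero hM
  have hL0 : L ≠ 0 := by rintro rfl; simp at hL
  obtain ⟨b, hb⟩ := Multiset.exists_mem_of_ne_zero hL0
  -- Leg lengths are totally ordered although the ring is not. If `b ≤ a`, the legs of `L` other
  -- than `b` move to the root; otherwise `h` and the legs of `M` other than `a` move to the far
  -- end. The leg left behind absorbs the `d` edges of the path.
  rcases le_total b a with hab | hab
  · obtain ⟨L, rfl⟩ := Multiset.exists_cons_of_mem hb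
    refine ⟨(d + b) ::ₘ (M + L), ?_, ?_, ?_, ?_⟩
    · simp at hL ⊢; omega
    · simp; omega
    · intro c hc
      simp only [Multiset.mem_cons, Multiset.mem_add] at hc hLpos
      rcases hc with rfl | hc | hc
      · omega
      · exact hMpos c hc
      · exact hLpos c (Or.inr hc)
    · have hdom : PairDom (leg x b) (h * starPair x M) :=
        (pairDom_starPair hx hab ha).mul_left (pairNonneg_leg hx _)
          (pairNonneg_starPair hx _) hh
      have := pairTotal_transfer_le hx d hdom (pairNonneg_starPair hx L)
      rw [starPair_cons, starPair_cons, starPair_add]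
      rw [plant_iterate_leg] at this
      convert this using 2
      ring
  · obtain ⟨M, rfl⟩ := Multiset.exists_cons_of_mem ha
    refine ⟨(d + a) ::ₘ (M + L), ?_, ?_, ?_, ?_⟩
    · simp at hL ⊢; omega
    · simp; omega
    · intro c hc
      simp only [Multiset.mem_cons, Multiset.mem_add] at hc hMpos
      rcases hc with rfl | hc | hc
      · omega
      · exact hMpos c (Or.inr hc)
      · exact hLpos c hc
    · have := pairTotal_transfer_le hx d (pairDom_starPair hx hab hb)
        (hh.mul (pairNonneg_starPair hx M))
      rw [starPair_cons, starPair_cons, starPair_add, pairTotal_mul_plant_iterate,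
        mul_comm ((plant x)^[d] _), mul_left_comm h (leg x a)]
      rw [plant_iterate_leg] at this
      convert this using 2
      ring

/-- If both brooms branch, choose a leg in each. The one containing the longer leg still dominates
through its handle, so the other can be dissolved into legs at the root; `exists_merge_broom` then
removes the remaining handle. -/
theorem exists_merge_two_brooms (hx : 0 ≤ x) {h : A[ε]} (hh : PairNonneg h) {M L : Multiset ℕ}
    {d e : ℕ} (hd : 0 < d) (he : 0 < e) (hMpos : ∀ a ∈ M, 0 < a) (hLpos : ∀ a ∈ L, 0 < a)
    (hL : L = 0 ∨ 2 ≤ L.card) (hM : M = 0 ∨ 2 ≤ M.card) :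
    ∃ N : Multiset ℕ, N.card = max 1 M.card + max 1 L.card ∧ N.sum = e + M.sum + d + L.sum ∧
      (∀ a ∈ N, 0 < a) ∧
      pairTotal x (h * starPair x N) ≤
        pairTotal x (h * (plant x)^[e] (starPair x M) * (plant x)^[d] (starPair x L)) := by
  have key : ∀ {M L : Multiset ℕ} {d e b c : ℕ}, 0 < d → 0 < e → (∀ a ∈ M, 0 < a) →
      (∀ a ∈ L, 0 < a) → 2 ≤ L.card → 2 ≤ M.card → b ∈ L → c ∈ M → b ≤ c →
      ∃ N : Multiset ℕ, N.card = max 1 M.card + max 1 L.card ∧ N.sum = e + M.sum + d + L.sum ∧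
      (∀ a ∈ N, 0 < a) ∧
      pairTotal x (h * starPair x N) ≤
        pairTotal x (h * (plant x)^[e] (starPair x M) * (plant x)^[d] (starPair x L)) := by
    clear! M L d e
    intro M L d e b c hd he hMpos hLpos hL hM hb hc hbc
    obtain ⟨L, rfl⟩ := Multiset.exists_cons_of_mem hb
    have hpos : ∀ a ∈ (d + b) ::ₘ L, 0 < a := by
      intro a ha
      simp only [Multiset.mem_cons] at ha hLpos
      rcases ha with rfl | ha
      · omega
      · exact hLpos a (Or.inr ha)
    obtain ⟨N, h1, h2, h3, h4⟩ := exists_merge_broom hx hh (M := (d + b) ::ₘ L) (L := M) (d := e)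
      (by simp) he hpos hMpos (Or.inr hM)
    refine ⟨N, ?_, ?_, h3, h4.trans ?_⟩
    · simp at h1 hL ⊢; omega
    · simp at h2 ⊢; omega
    · have hdom : PairDom (leg x b) (h * (plant x)^[e] (starPair x M)) :=
        PairDom.mul_left (pairDom_plant_iterate hx (pairNonneg_starPair hx M)
          (fun b hb => pairDom_starPair hx hb hc) e b hbc) (pairNonneg_leg hx _)
          ((pairNonneg_starPair hx _).plant_iterate hx e) hh
      have := pairTotal_transfer_le hx d hdom (pairNonneg_starPair hx L)
      rw [plant_iterate_leg] at this
      rw [starPair_cons, starPair_cons]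
      convert this using 2
      ring
  rcases hL with rfl | hL
  · obtain ⟨N, h1, h2, h3, h4⟩ := exists_merge_broom hx hh (M := {d}) (L := M) (d := e)
      (by simp) he (by simpa using hd) hMpos hM
    refine ⟨N, ?_, ?_, h3, h4.trans (le_of_eq ?_)⟩
    · simp at h1 ⊢; omega
    · simp at h2 ⊢; omega
    · rw [starPair_zero, ← Multiset.cons_zero, starPair_cons, starPair_zero,
        show (plant x)^[d] 1 = leg x d from rfl]
      congr 1; ring
  rcases hM with rfl | hM
  · obtain ⟨N, h1, h2, h3, h4⟩ := exists_merge_broom hx hh (M := {e}) (L := L) (d := d)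
      (by simp) hd (by simpa using he) hLpos (Or.inr hL)
    refine ⟨N, ?_, ?_, h3, h4.trans (le_of_eq ?_)⟩
    · simp at h1 ⊢; omega
    · simp at h2 ⊢; omega
    · rw [starPair_zero, ← Multiset.cons_zero, starPair_cons, starPair_zero,
        show (plant x)^[e] 1 = leg x e from rfl, mul_one]
  have hL0 : L ≠ 0 := by rintro rfl; simp at hL
  have hM0 : M ≠ 0 := by rintro rfl; simp at hM
  obtain ⟨b, hb⟩ := Multiset.exists_mem_of_ne_zero hL0
  obtain ⟨c, hc⟩ := Multiset.exists_mem_of_ne_zero hM0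
  rcases le_total b c with hbc | hbc
  · exact key hd he hMpos hLpos hL hM hb hc hbc
  · obtain ⟨N, h1, h2, h3, h4⟩ := key he hd hLpos hMpos hM hL hc hb hbc
    refine ⟨N, by omega, by omega, h3, h4.trans (le_of_eq ?_)⟩
    congr 1; ring

end RootedPairs

/-! ### Balancing the legs of a starlike tree -/

section Balancing

variable {A : Type*} [CommRing A] [PartialOrder A] [IsOrderedRing A] [IsDomain A] {x : A}

omit [IsDomain A] in
theorem snd_leg_succ_ne_zero (hx : 0 < x) (d : ℕ) : (leg x (d + 1)).snd ≠ 0 := by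
  have h1 : x ≤ pairTotal x (leg x d) := by
    refine le_add_of_nonneg_of_le (pairNonneg_leg hx.le d).2 ?_
    simpa using mul_le_mul_of_nonneg_left (one_le_fst_leg hx.le d) hx.le
  rw [leg_succ, snd_plant]
  exact (hx.trans_le h1).ne'

theorem fst_starPair_ne_zero (hx : 0 < x) (L : Multiset ℕ) : (starPair x L).fst ≠ 0 :=
  (zero_lt_one.trans_le (one_le_fst_starPair hx.le L)).ne'

theorem exists_balanced (hx : 0 < x) (N : Multiset ℕ) :
    ∃ N₀ : Multiset ℕ, (∃ k, ∀ a ∈ N₀, a = k ∨ a = k + 1) ∧ N₀.card = N.card ∧ N₀.sum = N.sum ∧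
      (starPair x N₀).fst ≤ (starPair x N).fst ∧
      pairTotal x (starPair x N₀) ≤ pairTotal x (starPair x N) ∧
      ((starPair x N₀).fst = (starPair x N).fst → N₀ = N) := by
  -- Replacing legs `b + d + 2`, `b` by `b + d + 1`, `b + 1` keeps size and sum but lowers the sum
  -- of squares.
  induction hs : (N.map (· ^ 2)).sum using Nat.strong_induction_on generalizing N with
  | _ s ih =>
  by_cases hgap : ∃ a ∈ N, ∃ b ∈ N, b + 2 ≤ a
  · obtain ⟨a, ha, b, hb, hab⟩ := hgap
    obtain ⟨d, rfl⟩ := Nat.exists_eq_add_of_le hab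
    obtain ⟨M, rfl⟩ := Multiset.exists_cons_of_mem ha
    have hb' : b ∈ M := by
      rcases Multiset.mem_cons.1 hb with h | h
      · omega
      · exact h
    obtain ⟨M, rfl⟩ := Multiset.exists_cons_of_mem hb'
    have e : b + 2 + d = b + d + 2 := by ring
    rw [e] at *
    have hfst : (starPair x ((b + d + 2) ::ₘ b ::ₘ M)).fst =
        (starPair x ((b + d + 1) ::ₘ (b + 1) ::ₘ M)).fst +
          (leg x (d + 1)).snd * (starPair x M).fst := by
      simp only [starPair_cons, TrivSqZeroExt.fst_mul]
      linear_combination (starPair x M).fst * fst_leg_mul_fst_leg x b d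
    have hpos : 0 ≤ (leg x (d + 1)).snd := (pairNonneg_leg hx.le _).2
    -- The two legs alone form one path whose total is unaffected by the shift, so only their minor
    -- matters for the total with `M` attached.
    have htot : pairTotal x (starPair x ((b + d + 1) ::ₘ (b + 1) ::ₘ M)) ≤
        pairTotal x (starPair x ((b + d + 2) ::ₘ b ::ₘ M)) := by
      simp only [starPair_cons, ← mul_assoc]
      rw [mul_comm _ (starPair x M), mul_comm _ (starPair x M), pairTotal_mul x (starPair x M),
        pairTotal_mul x (starPair x M), ← pairTotal_leg_shift]
      gcongr
      · exact (pairNonneg_starPair hx.le M).2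
      · rw [TrivSqZeroExt.fst_mul, TrivSqZeroExt.fst_mul, fst_leg_mul_fst_leg]
        exact le_add_of_nonneg_right hpos
    obtain ⟨N₀, h1, h2, h3, h4, h5, -⟩ := ih _ (by
      rw [← hs]; simp only [Multiset.map_cons, Multiset.sum_cons]; nlinarith)
      ((b + d + 1) ::ₘ (b + 1) ::ₘ M) rfl
    have hM := pairNonneg_starPair hx.le M
    refine ⟨N₀, h1, by simpa using h2, ?_, ?_, h5.trans htot, ?_⟩
    · simp at h3 ⊢; omega
    · rw [hfst]; exact le_add_of_le_of_nonneg h4 (mul_nonneg hpos hM.1)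
    · intro heq
      exfalso
      rw [hfst] at heq
      rw [heq] at h4
      have h6 := le_antisymm (nonpos_of_add_le_right h4) (mul_nonneg hpos hM.1)
      exact mul_ne_zero (snd_leg_succ_ne_zero hx d) (fst_starPair_ne_zero hx M) h6
  · push Not at hgap
    refine ⟨N, ?_, rfl, rfl, le_rfl, le_rfl, fun _ => rfl⟩
    by_cases hN : N = 0
    · exact ⟨0, by simp [hN]⟩
    · obtain ⟨k, hk, hmin⟩ : ∃ k ∈ N, ∀ a ∈ N, k ≤ a := by
        have : N.toFinset.Nonempty := by simpa using hN
        obtain ⟨k, hk, h⟩ := N.toFinset.exists_min_image id this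
        exact ⟨k, by simpa using hk, fun a ha => h a (by simpa using ha)⟩
      refine ⟨k, fun a ha => ?_⟩
      have := hgap a ha k hk
      have := hmin a ha
      omega

end Balancing

/-- A multiset with entries in `{k, k + 1}` is determined by its size and its sum. -/
theorem Multiset.eq_of_balanced {M N : Multiset ℕ} (hM : ∃ k, ∀ a ∈ M, a = k ∨ a = k + 1)
    (hN : ∃ k, ∀ a ∈ N, a = k ∨ a = k + 1) (hcard : M.card = N.card) (hsum : M.sum = N.sum) :
    M = N := by
  have key : ∀ {M : Multiset ℕ} {k : ℕ}, (∀ a ∈ M, a = k ∨ a = k + 1) →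
      ∃ i j, M = replicate i k + replicate j (k + 1) := by
    intro M k h
    induction M using Multiset.induction with
    | empty => exact ⟨0, 0, by simp⟩
    | cons a M ih =>
      obtain ⟨i, j, hij⟩ := ih fun b hb => h b (Multiset.mem_cons_of_mem hb)
      rcases h a (Multiset.mem_cons_self a M) with rfl | rfl
      · exact ⟨i + 1, j, by rw [hij, replicate_succ, cons_add]⟩
      · exact ⟨i, j + 1, by rw [hij, replicate_succ, add_cons]⟩
  obtain ⟨k, hk⟩ := hM
  obtain ⟨m, hm⟩ := hN
  obtain ⟨i, j, rfl⟩ := key hk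
  obtain ⟨i', j', rfl⟩ := key hm
  simp only [card_add, card_replicate, sum_add, sum_replicate, smul_eq_mul] at hcard hsum
  -- For `k < m` the left sum is at most `(i + j) * (k + 1)`, and the right one at least `(i' + j')
  -- * m`; equality must hold throughout.
  have aux : ∀ {i j i' j' k m : ℕ}, i + j = i' + j' → i * k + j * (k + 1) = i' * m + j' * (m + 1) →
      k < m → i = 0 ∧ j' = 0 ∧ (m = k + 1 ∨ j = 0) := by
    intro i j i' j' k m h1 h2 hkm
    obtain ⟨t, rfl⟩ := Nat.exists_eq_add_of_lt hkm
    have e : i * k + j * (k + 1) = (i + j) * k + j := by ring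
    have e' : i' * (k + t + 1) + j' * (k + t + 1 + 1) = (i' + j') * k + (i' + j') * (t + 1) + j' := by
      ring
    rw [e, e', ← h1] at h2
    have h3 : j = (i + j) * (t + 1) + j' := by omega
    have h4 : i = 0 ∧ j' = 0 := by constructor <;> nlinarith [Nat.zero_le ((i + j) * t)]
    obtain ⟨rfl, rfl⟩ := h4
    refine ⟨rfl, rfl, ?_⟩
    simp only [zero_add, add_zero] at h3
    rcases Nat.eq_zero_or_pos j with h | h
    · exact Or.inr h
    · left
      have : t + 1 = 1 := Nat.eq_of_mul_eq_mul_left h (by omega)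
      omega
  rcases lt_trichotomy k m with h | rfl | h
  · obtain ⟨rfl, rfl, rfl | rfl⟩ := aux hcard hsum h
    · simp at hcard; simp [hcard]
    · have : i' = 0 := by omega
      simp [this]
  · have e : i * k + j * (k + 1) = (i + j) * k + j := by ring
    have e' : i' * k + j' * (k + 1) = (i' + j') * k + j' := by ring
    rw [e, e', hcard] at hsum
    obtain rfl : j = j' := by omega
    obtain rfl : i = i' := by omega
    rfl
  · obtain ⟨rfl, rfl, rfl | rfl⟩ := aux hcard.symm hsum.symm h
    · simp at hcard; simp [hcard]
    · have : i = 0 := by omega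
      simp [this]

/-! ### Plane trees and the minimality of starlike trees -/

/-- Rooted plane trees: `nil` is the one-vertex tree, and `cons b r` is `r` with an additional
edge from its root to the root of `b`. -/
inductive PlaneTree : Type
  | nil : PlaneTree
  | cons (b r : PlaneTree) : PlaneTree

namespace PlaneTree

/-- The number of edges. -/
def edges : PlaneTree → ℕ
  | nil => 0
  | cons b r => b.edges + 1 + r.edges

/-- The number of leaves different from the root. -/
def leaves : PlaneTree → ℕ
  | nil => 0
  | cons nil r => 1 + r.leaves
  | cons (cons b s) r => (cons b s).leaves + r.leaves

/-- The degree of the root. -/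
def children : PlaneTree → ℕ
  | nil => 0
  | cons _ r => r.children + 1

/-- The path with `a` edges rooted at an end. -/
def path : ℕ → PlaneTree
  | 0 => nil
  | a + 1 => cons (path a) nil

/-- The starlike tree whose legs have `a + 1` edges for `a` in the list. -/
def starlike : List ℕ → PlaneTree
  | [] => nil
  | a :: l => cons (path a) (starlike l)

/-- The leaves of `b` once its root has been joined to a new root. -/
def branchLeaves : PlaneTree → ℕ
  | nil => 1
  | cons b r => (cons b r).leaves

theorem leaves_cons (b r : PlaneTree) : (cons b r).leaves = b.branchLeaves + r.leaves := by
  cases b <;> simp [leaves, branchLeaves]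

section Pair

variable {A : Type*} [CommRing A] (x : A)

/-- The pair (principal minor at the root, excess) of a plane tree. -/
def pair : PlaneTree → A[ε]
  | nil => 1
  | cons b r => plant x b.pair * r.pair

theorem pair_path (a : ℕ) : (path a).pair x = leg x a := by
  induction a with
  | zero => rfl
  | succ a ih => simp [path, pair, ih, leg_succ]

theorem pair_starlike (l : List ℕ) :
    (starlike l).pair x = starPair x ((l : Multiset ℕ).map (· + 1)) := by
  induction l with
  | nil => simp [starlike, pair]
  | cons a l ih =>
    rw [starlike, pair, ih, pair_path, ← leg_succ, ← Multiset.cons_coe, Multiset.map_cons,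
      starPair_cons]

variable {x} [PartialOrder A] [IsOrderedRing A]

theorem pairNonneg_pair (hx : 0 ≤ x) (t : PlaneTree) : PairNonneg (t.pair x) := by
  induction t with
  | nil => exact PairNonneg.one
  | cons b r hb hr => exact (hb.plant hx).mul hr

theorem one_le_fst_pair (hx : 0 ≤ x) (t : PlaneTree) : 1 ≤ (t.pair x).fst := by
  induction t with
  | nil => simp [pair]
  | cons b r hb hr =>
    rw [pair, TrivSqZeroExt.fst_mul]
    exact one_le_mul_of_one_le_of_one_le
      (hb.trans (fst_le_fst_plant hx (pairNonneg_pair hx b))) hr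

/-- The context `h` stands for whatever else hangs at the root. It must be arbitrary because
transfers may carry the root's other branches along a path: they control the total of the whole
tree, not the pair of the part being changed. A root with a single child keeps a handle of `d`
edges, since without a second branch there is nothing at the root to merge with. -/
theorem exists_pairTotal_le_aux (hx : 0 ≤ x) (t : PlaneTree) (ht : t ≠ nil) {h : A[ε]}
    (hh : PairNonneg h) :
    (t.children = 1 ∧ ∃ (d : ℕ) (L : Multiset ℕ), 0 < d ∧ (L = 0 ∨ 2 ≤ L.card) ∧
      max 1 L.card = t.leaves ∧ d + L.sum = t.edges ∧ (∀ a ∈ L, 0 < a) ∧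
      pairTotal x (h * (plant x)^[d] (starPair x L)) ≤ pairTotal x (h * t.pair x)) ∨
    (2 ≤ t.children ∧ ∃ L : Multiset ℕ, 2 ≤ L.card ∧
      L.card = t.leaves ∧ L.sum = t.edges ∧ (∀ a ∈ L, 0 < a) ∧
      pairTotal x (h * starPair x L) ≤ pairTotal x (h * t.pair x)) := by
  induction t generalizing h with
  | nil => exact absurd rfl ht
  | cons b r ihb ihr =>
    -- Re-rooting at the root of `b` puts the joining edge into the context, so the induction
    -- hypothesis applies with `plant x h`.
    have branch : ∀ {h : A[ε]}, PairNonneg h → ∃ (d : ℕ) (L : Multiset ℕ), 0 < d ∧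
        (L = 0 ∨ 2 ≤ L.card) ∧ max 1 L.card = b.branchLeaves ∧ d + L.sum = b.edges + 1 ∧
        (∀ a ∈ L, 0 < a) ∧ pairTotal x (h * (plant x)^[d] (starPair x L)) ≤
          pairTotal x (h * plant x (b.pair x)) := by
      intro h hh
      cases b with
      | nil => exact ⟨1, 0, by simp [branchLeaves, edges, pair]⟩
      | cons c s =>
        rw [pairTotal_mul_plant]
        rcases ihb (by simp) (hh.plant hx) with ⟨-, d, L, h1, h2, h3, h4, h5, h6⟩ |
          ⟨-, L, h1, h2, h3, h4, h5⟩
        · refine ⟨d + 1, L, by omega, h2, h3, by omega, h5, ?_⟩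
          rwa [Function.iterate_succ_apply', pairTotal_mul_plant]
        · refine ⟨1, L, by omega, Or.inr h1, ?_, by omega, h4, ?_⟩
          · rw [branchLeaves]; omega
          · rwa [Function.iterate_one, pairTotal_mul_plant]
    have hplant := (pairNonneg_pair hx b).plant hx
    cases r with
    | nil =>
      left
      obtain ⟨d, L, h1, h2, h3, h4, h5, h6⟩ := branch hh
      refine ⟨rfl, d, L, h1, h2, ?_, ?_, h5, ?_⟩
      · rw [leaves_cons, h3]; rfl
      · rw [h4]; rfl
      · simpa [pair] using h6
    | cons c s =>
      right
      refine ⟨by simp [children], ?_⟩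
      set r := cons c s with hr
      have e : h * (cons b r).pair x = h * plant x (b.pair x) * r.pair x := by
        rw [pair, mul_assoc]
      rw [e]
      -- The siblings are reduced with the untouched branch in the context, then the branch with the
      -- reduced siblings in the context.
      rcases ihr (by simp [hr]) (hh.mul hplant) with ⟨-, e, M, m1, m2, m3, m4, m5, m6⟩ |
        ⟨-, M, m1, m2, m3, m4, m5⟩
      · obtain ⟨d, L, h1, h2, h3, h4, h5, h6⟩ :=
          branch (hh.mul ((pairNonneg_starPair hx M).plant_iterate hx e))
        obtain ⟨N, n1, n2, n3, n4⟩ := exists_merge_two_brooms hx hh h1 m1 m5 h5 h2 m2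
        refine ⟨N, by omega, ?_, ?_, n3, n4.trans (h6.trans ?_)⟩
        · rw [leaves_cons]; omega
        · rw [edges]; omega
        · refine le_of_eq_of_le ?_ m6
          congr 1; ring
      · obtain ⟨d, L, h1, h2, h3, h4, h5, h6⟩ := branch (hh.mul (pairNonneg_starPair hx M))
        obtain ⟨N, n1, n2, n3, n4⟩ := exists_merge_broom hx hh
          (Multiset.card_pos.1 (by omega)) h1 m4 h5 h2
        refine ⟨N, by omega, ?_, ?_, n3, n4.trans (h6.trans ?_)⟩
        · rw [leaves_cons]; omega
        · rw [edges]; omega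
        · refine le_of_eq_of_le ?_ m5
          congr 1; ring

/-- Among the trees with given order and number of leaves, `det (x + L)` is minimized by a
starlike tree. -/
theorem exists_pairTotal_le (hx : 0 ≤ x) (t : PlaneTree) (ht : 2 ≤ t.children) :
    ∃ L : Multiset ℕ, L.card = t.leaves ∧ L.sum = t.edges ∧ (∀ a ∈ L, 0 < a) ∧
      pairTotal x (starPair x L) ≤ pairTotal x (t.pair x) := by
  have hne : t ≠ nil := by rintro rfl; simp [children] at ht
  rcases exists_pairTotal_le_aux hx t hne PairNonneg.one with ⟨h, -⟩ | ⟨-, L, -, h1, h2, h3, h4⟩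
  · omega
  · exact ⟨L, h1, h2, h3, by simpa using h4⟩

theorem mul_eq_mul_of_le [IsDomain A] {a b c d : A} (ha : 0 ≤ a) (ha' : a ≠ 0) (hd : d ≠ 0)
    (hd' : 0 ≤ d) (hab : a ≤ b) (hcd : c ≤ d) (h : a * c = b * d) : a = b ∧ c = d := by
  have h1 : 0 ≤ (b - a) * d := mul_nonneg (sub_nonneg.2 hab) hd'
  have h2 : 0 ≤ a * (d - c) := mul_nonneg ha (sub_nonneg.2 hcd)
  have h3 : (b - a) * d + a * (d - c) = 0 := by linear_combination -h
  obtain ⟨h4, h5⟩ := (add_eq_zero_iff_of_nonneg h1 h2).1 h3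
  constructor
  · rcases mul_eq_zero.1 h4 with h | h
    · exact (sub_eq_zero.1 h).symm
    · exact absurd h hd
  · rcases mul_eq_zero.1 h5 with h | h
    · exact absurd h ha'
    · exact (sub_eq_zero.1 h).symm

theorem snd_pair_cons_ne_zero (hx : 0 < x) (b r : PlaneTree) :
    ((cons b r).pair x).snd ≠ 0 := by
  have hb := pairNonneg_pair hx.le b
  have hr := pairNonneg_pair hx.le r
  have h1 : x ≤ pairTotal x (b.pair x) := by
    refine le_add_of_nonneg_of_le hb.2 ?_
    simpa using mul_le_mul_of_nonneg_left (one_le_fst_pair hx.le b) hx.le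
  have h2 : x ≤ ((cons b r).pair x).snd := by
    rw [pair, DualNumber.snd_mul, snd_plant]
    refine le_add_of_nonneg_of_le (mul_nonneg (hb.plant hx.le).1 hr.2) ?_
    refine h1.trans ?_
    simpa using mul_le_mul_of_nonneg_left (one_le_fst_pair hx.le r) (hx.le.trans h1)
  exact (hx.trans_le h2).ne'

variable [IsDomain A]

/-- The principal minor at the root is minimized by starlike trees, and only by them. -/
theorem exists_fst_le (hx : 0 < x) (t : PlaneTree) :
    (∃ N : Multiset ℕ, N.card = t.leaves ∧ N.sum = t.edges ∧
      (starPair x N).fst ≤ (t.pair x).fst ∧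
      ((starPair x N).fst = (t.pair x).fst →
        ∃ l : List ℕ, t = starlike l ∧ N = (l : Multiset ℕ).map (· + 1))) ∧
    ∀ d, 0 < d → ∃ N : Multiset ℕ, N.card = t.branchLeaves ∧ N.sum = t.edges + d ∧
      (starPair x N).fst ≤ ((plant x)^[d] (t.pair x)).fst ∧
      ((starPair x N).fst = ((plant x)^[d] (t.pair x)).fst →
        ∃ a, t = path a ∧ N = {a + d}) := by
  induction t with
  | nil =>
    refine ⟨⟨0, rfl, rfl, by simp [pair], fun _ => ⟨[], rfl, rfl⟩⟩, fun d _ => ?_⟩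
    refine ⟨{d}, rfl, by simp [edges], ?_, fun _ => ⟨0, rfl, by simp⟩⟩
    rw [← Multiset.cons_zero, starPair_cons, starPair_zero, mul_one]; exact le_rfl
  | cons b r ihb ihr =>
    obtain ⟨-, ihb⟩ := ihb
    obtain ⟨⟨M, m1, m2, m3, m4⟩, -⟩ := ihr
    have nb := pairNonneg_pair hx.le b
    have nr := pairNonneg_pair hx.le r
    have hr1 := one_le_fst_pair hx.le r
    -- Deleting the root disconnects its branches, so the minor is a product and equality can be
    -- tested factor by factor.
    have combine : ∀ {N : Multiset ℕ} {z : A}, (starPair x N).fst ≤ z →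
        (starPair x (N + M)).fst ≤ z * (r.pair x).fst ∧
        ((starPair x (N + M)).fst = z * (r.pair x).fst →
          (starPair x N).fst = z ∧ (starPair x M).fst = (r.pair x).fst) := by
      intro N z hz
      have hN := one_le_fst_starPair hx.le N
      have hM := one_le_fst_starPair hx.le M
      rw [starPair_add, TrivSqZeroExt.fst_mul]
      refine ⟨mul_le_mul hz m3 (zero_le_one.trans hM) (zero_le_one.trans (hN.trans hz)),
        fun h => ?_⟩
      exact mul_eq_mul_of_le (zero_le_one.trans hN) (zero_lt_one.trans_le hN).ne'
        (zero_lt_one.trans_le hr1).ne' (zero_le_one.trans hr1) hz m3 h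
    constructor
    · obtain ⟨N, n1, n2, n3, n4⟩ := ihb 1 one_pos
      obtain ⟨h1, h2⟩ := combine n3
      refine ⟨N + M, ?_, ?_, by rwa [pair, TrivSqZeroExt.fst_mul], fun h => ?_⟩
      · rw [leaves_cons, Multiset.card_add, n1, m1]
      · rw [edges, Multiset.sum_add, n2, m2]
      · rw [pair, TrivSqZeroExt.fst_mul] at h
        obtain ⟨h3, h4⟩ := h2 h
        obtain ⟨a, rfl, rfl⟩ := n4 h3
        obtain ⟨l, rfl, rfl⟩ := m4 h4
        exact ⟨a :: l, rfl, by simp⟩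
    · intro d hd
      obtain ⟨N, n1, n2, n3, n4⟩ := ihb (d + 1) (by omega)
      obtain ⟨h1, h2⟩ := combine n3
      obtain ⟨α, β, hα, hβ, hβ', hf⟩ := exists_fst_plant_iterate hx.le d
      -- The β-term is the cost of leaving `r` at the end of a path of `d` edges instead of moving
      -- it to the root. For `0 < d` it vanishes only if `r` is trivial.
      have key : ((plant x)^[d] ((cons b r).pair x)).fst =
          ((plant x)^[d + 1] (b.pair x)).fst * (r.pair x).fst +
            β * ((plant x (b.pair x)).fst * (r.pair x).snd) := by
        rw [Function.iterate_succ_apply, hf, hf, pair, TrivSqZeroExt.fst_mul, DualNumber.snd_mul]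
        ring
      have hnn : 0 ≤ β * ((plant x (b.pair x)).fst * (r.pair x).snd) :=
        mul_nonneg hβ (mul_nonneg (nb.plant hx.le).1 nr.2)
      refine ⟨N + M, ?_, ?_, ?_, fun h => ?_⟩
      · rw [branchLeaves, leaves_cons, Multiset.card_add, n1, m1]
      · rw [edges, Multiset.sum_add, n2, m2]; ring
      · rw [key]; exact le_add_of_le_of_nonneg h1 hnn
      · rw [key] at h
        have hz : β * ((plant x (b.pair x)).fst * (r.pair x).snd) = 0 := by
          rw [h] at h1
          exact le_antisymm (nonpos_of_add_le_right h1) hnn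
        have hrn : r = nil := by
          cases r with
          | nil => rfl
          | cons c s =>
            exfalso
            refine mul_ne_zero (zero_lt_one.trans_le (hβ' hd)).ne' (mul_ne_zero ?_
              (snd_pair_cons_ne_zero hx c s)) hz
            exact (zero_lt_one.trans_le
              ((one_le_fst_pair hx.le b).trans (fst_le_fst_plant hx.le nb))).ne'
        rw [hz, add_zero] at h
        obtain ⟨h3, h4⟩ := h2 h
        obtain ⟨a, rfl, rfl⟩ := n4 h3
        subst hrn
        refine ⟨a + 1, rfl, ?_⟩
        have : M = 0 := by simpa [leaves] using m1
        rw [this, add_zero]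
        congr 1; ring

/-- Comparison of a plane tree with the balanced starlike tree of the same order and the same
number of leaves. -/
theorem balanced_le (hx : 0 < x) (t : PlaneTree) (ht : 2 ≤ t.children) {l : List ℕ}
    (hl : ∃ k, ∀ a ∈ l, a = k ∨ a = k + 1) (hcard : l.length = t.leaves)
    (hsum : l.sum + l.length = t.edges) :
    (((starlike l).pair x).fst ≤ (t.pair x).fst ∧
      pairTotal x ((starlike l).pair x) ≤ pairTotal x (t.pair x)) ∧
    (((starlike l).pair x).fst = (t.pair x).fst → ∃ l', t = starlike l' ∧ l.Perm l') := by
  have hbal : ∃ k, ∀ a ∈ (l : Multiset ℕ).map (· + 1), a = k ∨ a = k + 1 := by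
    obtain ⟨k, hk⟩ := hl
    refine ⟨k + 1, fun a ha => ?_⟩
    obtain ⟨b, hb, rfl⟩ := Multiset.mem_map.1 ha
    have := hk b hb
    omega
  have hs : ((l : Multiset ℕ).map (· + 1)).sum = t.edges := by
    rw [Multiset.sum_map_add]; simpa using hsum
  have hc : ((l : Multiset ℕ).map (· + 1)).card = t.leaves := by simpa using hcard
  have huniq : ∀ N₀ : Multiset ℕ, (∃ k, ∀ a ∈ N₀, a = k ∨ a = k + 1) → N₀.card = t.leaves →
      N₀.sum = t.edges → N₀ = (l : Multiset ℕ).map (· + 1) := fun N₀ h1 h2 h3 =>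
    Multiset.eq_of_balanced h1 hbal (h2.trans hc.symm) (h3.trans hs.symm)
  rw [pair_starlike]
  -- `L` serves the total and `N` below the minor; `huniq` identifies both balanced versions with
  -- the given tree. Only the minor yields the equality case.
  obtain ⟨L, h1, h2, -, h3⟩ := exists_pairTotal_le hx.le t ht
  obtain ⟨L₀, b1, b2, b3, -, b4, -⟩ := exists_balanced hx L
  obtain rfl := huniq L₀ b1 (b2.trans h1) (b3.trans h2)
  obtain ⟨⟨N, n1, n2, n3, n4⟩, -⟩ := exists_fst_le hx t
  obtain ⟨N₀, c1, c2, c3, c4, -, c5⟩ := exists_balanced hx N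
  obtain rfl := huniq N₀ c1 (c2.trans n1) (c3.trans n2)
  refine ⟨⟨c4.trans n3, b4.trans h3⟩, fun h => ?_⟩
  rw [h] at c4 c5
  have e := le_antisymm n3 c4
  obtain ⟨l', rfl, rfl⟩ := n4 e
  refine ⟨l', rfl, ?_⟩
  rw [← Multiset.coe_eq_coe]
  exact Multiset.map_injective (add_left_injective 1) (c5 e.symm)

end Pair

end PlaneTree

/-! ### Determinants of glued matrices and a nonnegativity criterion -/

namespace Matrix

section Glue

variable {R V W : Type*} [CommRing R] [Fintype V] [DecidableEq V] [Fintype W] [DecidableEq W]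

/-- The index `r` of `A` is connected to the indices of `D` with weights `n`, and the diagonal
entry at `r` is increased by `c`. -/
def glue (A : Matrix V V R) (r : V) (D : Matrix W W R) (n : W → R) (c : R) :
    Matrix (V ⊕ W) (V ⊕ W) R :=
  fromBlocks (A + single r r c) (vecMulVec (Pi.single r 1) (-n))
    (vecMulVec (-n) (Pi.single r 1)) D

/-- The coefficient of the principal minor at `r` in `det (glue A r D n c)`. -/
def glueCoeff (D : Matrix W W R) (n : W → R) (c : R) : R :=
  c * D.det - n ⬝ᵥ (adjugate D *ᵥ n)

theorem det_add_single (A : Matrix V V R) (r : V) (k : R) :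
    (A + single r r k).det = A.det + k * adjugate A r r := by
  have : A + single r r k = A.updateRow r (A r + k • Pi.single r 1) := by
    ext i j
    by_cases hi : i = r
    · subst hi
      by_cases hj : j = i
      · subst hj; simp
      · simp [hj, Ne.symm hj]
    · simp [hi, Ne.symm hi]
  rw [this, det_updateRow_add, det_updateRow_smul, updateRow_eq_self, adjugate_apply]

theorem adjugate_glue_apply (A : Matrix V V R) (r : V) (D : Matrix W W R) (n : W → R) (c : R) :
    adjugate (glue A r D n c) (Sum.inl r) (Sum.inl r) = adjugate A r r * D.det := by
  rw [adjugate_apply, adjugate_apply, ← det_fromBlocks_zero₁₂ _ (vecMulVec (-n) (Pi.single r 1))]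
  congr 1
  ext (i | i) (j | j)
  · by_cases hi : i = r
    · subst hi
      simp [updateRow_apply, Pi.single_apply]
    · simp [updateRow_apply, hi, glue, Ne.symm hi]
  · by_cases hi : i = r
    · subst hi
      simp [updateRow_apply]
    · simp [updateRow_apply, hi, glue, vecMulVec_apply]
  · simp [updateRow_apply, glue]
  · simp [updateRow_apply, glue]

theorem det_glue [IsDomain R] (A : Matrix V V R) (r : V) (D : Matrix W W R) (n : W → R) (c : R)
    (hD : D.det ≠ 0) :
    (glue A r D n c).det = A.det * D.det + adjugate A r r * glueCoeff D n c := by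
  set d := D.det with hd
  set e : V → R := Pi.single r 1 with he
  -- Block elimination with denominators cleared: the adjugate replaces the inverse of `D`, and the
  -- resulting power of `d` is cancelled at the end.
  have hmul : glue A r D n c * fromBlocks (d • 1) 0 (vecMulVec (adjugate D *ᵥ n) e) 1 =
      fromBlocks (d • A + single r r (glueCoeff D n c)) (vecMulVec e (-n)) 0 D := by
    rw [glue, fromBlocks_multiply]
    congr 1
    · rw [vecMulVec_mul_vecMulVec]
      ext i j
      by_cases hi : i = r <;> by_cases hj : j = r
      · subst hi hj
        simp [vecMulVec_apply, glueCoeff, he, hd]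
        ring
      · simp [vecMulVec_apply, he, hj, Ne.symm hj]
      · simp [vecMulVec_apply, he, hi, Ne.symm hi]
      · simp [vecMulVec_apply, he, hi, Ne.symm hi]
    · simp [he]
    · rw [mul_vecMulVec, mulVec_mulVec, mul_adjugate, ← hd, smul_mulVec, one_mulVec]
      ext i j
      simp [vecMulVec_apply]
      ring
    · simp
  have hdet := congrArg det hmul
  rw [det_mul, det_fromBlocks_zero₁₂, det_fromBlocks_zero₂₁, det_add_single, det_smul, det_smul,
    adjugate_smul, ← hd] at hdet
  have : Nonempty V := ⟨r⟩
  have hpow : d ^ Fintype.card V = d ^ (Fintype.card V - 1) * d := by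
    rw [← pow_succ, Nat.sub_add_cancel Fintype.card_pos]
  refine mul_right_cancel₀ (pow_ne_zero (Fintype.card V) hD) ?_
  simp only [det_one, mul_one, smul_apply, smul_eq_mul] at hdet
  rw [hdet, hpow]
  ring

theorem det_glue_zero_unit [IsDomain R] (D : Matrix W W R) (n : W → R) (c : R)
    (hD : D.det ≠ 0) :
    (glue (0 : Matrix Unit Unit R) () D n c).det = glueCoeff D n c := by
  rw [det_glue _ _ _ _ _ hD, adjugate_subsingleton]
  simp

end Glue

section Nonneg

variable {R : Type*} [CommRing R] [PartialOrder R] [IsOrderedRing R]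

/-- Division is unavailable, so the induction contracts instead of eliminating: expanding along row
0 writes the determinant as a nonnegative combination of determinants of smaller matrices of the
same kind. -/
theorem det_nonneg_of_offDiag_nonpos_fin {n : ℕ} (M : Matrix (Fin n) (Fin n) R)
    (hoff : ∀ i j, i ≠ j → M i j ≤ 0) (hsum : ∀ i, 0 ≤ ∑ j, M i j) : 0 ≤ M.det := by
  induction n with
  | zero => simp
  | succ n ih =>
    have h0 : 0 ≤ (M.submatrix Fin.succ Fin.succ).det := by
      refine ih _ (fun i j hij => hoff _ _ (by simpa using hij)) fun i => ?_
      have := hsum i.succ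
      rw [Fin.sum_univ_succ] at this
      refine this.trans ?_
      simpa using hoff i.succ 0 (Fin.succ_ne_zero i)
    -- This difference is the determinant of `M` with row 0 replaced by e_0 - e_j. Adding column 0
    -- to column `j` turns it into a smaller determinant in which the two columns are merged, and
    -- merging preserves both hypotheses.
    have hj : ∀ j : Fin n, 0 ≤ (M.submatrix Fin.succ Fin.succ).det -
        (-1) ^ (j.succ : ℕ) * (M.submatrix Fin.succ j.succ.succAbove).det := by
      intro j
      set N := M.updateRow 0 (Pi.single 0 1 - Pi.single j.succ 1) with hN
      have e1 : N.det = (M.submatrix Fin.succ Fin.succ).det -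
          (-1) ^ (j.succ : ℕ) * (M.submatrix Fin.succ j.succ.succAbove).det := by
        rw [det_succ_row_zero, Fin.sum_univ_succ, Finset.sum_eq_single j]
        · have h1 : N.submatrix Fin.succ Fin.succ = M.submatrix Fin.succ Fin.succ := by
            ext i k; simp [hN, updateRow_apply]
          have h2 : N.submatrix Fin.succ j.succ.succAbove =
              M.submatrix Fin.succ j.succ.succAbove := by
            ext i k; simp [hN, updateRow_apply]
          rw [h2, Fin.succAbove_zero, h1]
          simp [hN, (Fin.succ_ne_zero j).symm]
          ring
        · intro k _ hk
          simp [hN, Fin.succ_ne_zero, hk]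
        · simp
      rw [← e1, ← det_updateCol_add_self N (Fin.succ_ne_zero j), det_succ_row_zero,
        Fin.sum_univ_succ, Finset.sum_eq_zero, add_zero]
      · have h3 : 0 ≤ ((N.updateCol j.succ fun k => N k j.succ + N k 0).submatrix
            Fin.succ Fin.succ).det := by
          have entry : ∀ i k, (N.updateCol j.succ fun k => N k j.succ + N k 0).submatrix
              Fin.succ Fin.succ i k = M i.succ k.succ + if k = j then M i.succ 0 else 0 := by
            intro i k
            by_cases hk : k = j
            · subst hk; simp [hN, updateRow_apply]
            · simp [hN, updateRow_apply, hk]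
          refine ih _ (fun i k hik => ?_) fun i => ?_
          · rw [entry]
            refine add_nonpos (hoff _ _ (by simpa using hik)) ?_
            split_ifs
            · exact hoff _ _ (Fin.succ_ne_zero i)
            · exact le_rfl
          · simp only [entry, Finset.sum_add_distrib]
            have := hsum i.succ
            rw [Fin.sum_univ_succ, add_comm] at this
            simpa using this
        rw [Fin.succAbove_zero]
        simpa [hN, updateCol_apply, (Fin.succ_ne_zero j).symm] using h3
      · intro k _
        by_cases hk : k = j
        · subst hk
          simp [hN, (Fin.succ_ne_zero k).symm]
        · simp [hN, Fin.succ_ne_zero, hk]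
    -- The corner entry is rewritten as the row sum minus the other entries of row 0.
    have expand : M.det = (∑ j, M 0 j) * (M.submatrix Fin.succ Fin.succ).det +
        ∑ j : Fin n, -M 0 j.succ * ((M.submatrix Fin.succ Fin.succ).det -
          (-1) ^ (j.succ : ℕ) * (M.submatrix Fin.succ j.succ.succAbove).det) := by
      rw [det_succ_row_zero, Fin.sum_univ_succ, Fin.sum_univ_succ (fun j => M 0 j), add_mul,
        Finset.sum_mul, add_assoc, ← Finset.sum_add_distrib, Fin.succAbove_zero]
      congr 1
      · simp
      · refine Finset.sum_congr rfl fun j _ => ?_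
        ring
    rw [expand]
    refine add_nonneg (mul_nonneg (hsum 0) h0) (Finset.sum_nonneg fun j _ => ?_)
    exact mul_nonneg (neg_nonneg.2 (hoff _ _ (Fin.succ_ne_zero j).symm)) (hj j)

/-- A matrix with nonpositive off-diagonal entries and nonnegative row sums has nonnegative
determinant. -/
theorem det_nonneg_of_offDiag_nonpos {n : Type*} [Fintype n] [DecidableEq n] (M : Matrix n n R)
    (hoff : ∀ i j, i ≠ j → M i j ≤ 0) (hsum : ∀ i, 0 ≤ ∑ j, M i j) : 0 ≤ M.det := by
  rw [← det_reindex_self (Fintype.equivFin n) M]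
  refine det_nonneg_of_offDiag_nonpos_fin _ (fun i j hij => hoff _ _ (by simpa using hij)) ?_
  intro i
  have := hsum ((Fintype.equivFin n).symm i)
  rw [← Equiv.sum_comp (Fintype.equivFin n).symm] at this
  simpa using this

end Nonneg

end Matrix

/-! ### Laplacian coefficients as coefficients of det(X + L) -/

/-- The coefficientwise order on integer polynomials. -/
noncomputable instance intPolynomialOrder : PartialOrder ℤ[X] :=
  PartialOrder.lift (fun p => p.coeff) Polynomial.coeff_injective

instance : IsOrderedRing ℤ[X] where
  add_le_add_left p q h r k := by simpa using h k
  zero_le_one k := by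
    change (0 : ℤ[X]).coeff k ≤ (1 : ℤ[X]).coeff k
    rw [coeff_one]; split_ifs <;> simp
  mul_le_mul_of_nonneg_left p hp q r h k := by
    simp only [coeff_mul]
    exact Finset.sum_le_sum fun i _ => mul_le_mul_of_nonneg_left (h _) (by simpa using hp i.1)
  mul_le_mul_of_nonneg_right p hp q r h k := by
    simp only [coeff_mul]
    exact Finset.sum_le_sum fun i _ => mul_le_mul_of_nonneg_right (h _) (by simpa using hp i.2)

theorem intPolynomial_X_pos : (0 : ℤ[X]) < X := by
  refine lt_of_le_of_ne (fun k => ?_) X_ne_zero.symm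
  change (0 : ℤ[X]).coeff k ≤ (X : ℤ[X]).coeff k
  rw [coeff_X]; split_ifs <;> simp

section LaplacianPolynomial

variable {V W : Type*} [Fintype V] [Fintype W]

open Classical in
theorem vertexDegree_eq_sum (G : SimpleGraph V) (v : V) :
    vertexDegree G v = ∑ w, if G.Adj v w then 1 else 0 := by
  have := G.degree_eq_sum_if_adj (R := ℕ) v
  simpa [vertexDegree] using this

theorem vertexDegree_iso {G : SimpleGraph V} {H : SimpleGraph W} (e : G ≃g H) (v : V) :
    vertexDegree H (e v) = vertexDegree G v := by
  classical
  rw [vertexDegree_eq_sum, vertexDegree_eq_sum, ← Equiv.sum_comp e.toEquiv]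
  refine Finset.sum_congr rfl fun w _ => ?_
  exact if_congr e.map_adj_iff rfl rfl

open Classical in
/-- The matrix `X + L(G)`. -/
noncomputable def shiftedLaplacian (G : SimpleGraph V) : Matrix V V ℤ[X] :=
  Matrix.of fun i j =>
    if i = j then X + (vertexDegree G i : ℤ[X]) else if G.Adj i j then -1 else 0

open Classical in
/-- The polynomial `det (X + L(G))`. -/
noncomputable def lapDet (G : SimpleGraph V) : ℤ[X] := (shiftedLaplacian G).det

open Classical in
/-- The principal minor of `X + L(G)` obtained by deleting `r`. -/
noncomputable def lapMinor (G : SimpleGraph V) (r : V) : ℤ[X] :=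
  (shiftedLaplacian G).adjugate r r

theorem lapDet_eq [DecidableEq V] (G : SimpleGraph V) : lapDet G = (shiftedLaplacian G).det := by
  unfold lapDet; congr!

theorem lapMinor_eq [DecidableEq V] (G : SimpleGraph V) (r : V) :
    lapMinor G r = (shiftedLaplacian G).adjugate r r := by
  unfold lapMinor; congr!

theorem shiftedLaplacian_iso {G : SimpleGraph V} {H : SimpleGraph W} (e : G ≃g H) :
    shiftedLaplacian G = (shiftedLaplacian H).submatrix e e := by
  classical
  ext1 i j
  rw [Matrix.submatrix_apply, shiftedLaplacian, shiftedLaplacian, Matrix.of_apply,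
    Matrix.of_apply, vertexDegree_iso e]
  exact if_congr e.injective.eq_iff.symm rfl (if_congr e.map_adj_iff.symm rfl rfl)

theorem lapDet_iso {G : SimpleGraph V} {H : SimpleGraph W} (e : G ≃g H) :
    lapDet G = lapDet H := by
  classical
  rw [lapDet_eq, lapDet_eq, shiftedLaplacian_iso e]
  exact Matrix.det_submatrix_equiv_self e.toEquiv _

theorem Matrix.charpoly_neg_coeff {R n : Type*} [CommRing R] [Fintype n] [DecidableEq n]
    (M : Matrix n n R) (j : ℕ) :
    (-M).charpoly.coeff j = (-1) ^ (Fintype.card n + j) * M.charpoly.coeff j := by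
  have h : M.charpoly.comp (-X) = (-1) ^ Fintype.card n * (-M).charpoly := by
    have e : (Polynomial.compRingHom (-X : R[X])).mapMatrix M.charmatrix =
        -(-M).charmatrix := by
      ext1 i k
      by_cases hik : i = k
      · subst hik
        simp [Matrix.charmatrix_apply_eq]
        ring
      · simp [Matrix.charmatrix_apply_ne _ _ _ hik]
    have := congrArg Matrix.det e
    rw [← RingHom.map_det, Matrix.det_neg] at this
    simpa [Matrix.charpoly] using this
  have h2 := congrArg (fun p => p.coeff j) h
  rw [show ((-1 : R[X]) ^ Fintype.card n) = C ((-1) ^ Fintype.card n) by simp] at h2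
  rw [show (-X : R[X]) = C (-1) * X by simp] at h2
  simp only [Polynomial.comp_C_mul_X_coeff, coeff_C_mul] at h2
  rw [pow_add, mul_assoc, mul_comm _ (M.charpoly.coeff j), h2, ← mul_assoc, ← mul_pow]
  simp

theorem lapDet_eq_charpoly [DecidableEq V] (G : SimpleGraph V) [DecidableRel G.Adj] :
    lapDet G = (-(G.lapMatrix ℤ)).charpoly := by
  have h : shiftedLaplacian G = (-(G.lapMatrix ℤ)).charmatrix := by
    ext1 i j
    by_cases hij : i = j
    · subst hij
      simp [shiftedLaplacian, Matrix.charmatrix_apply_eq, SimpleGraph.lapMatrix,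
        SimpleGraph.degMatrix, vertexDegree]
      congr!
    · rw [Matrix.charmatrix_apply_ne _ _ _ hij]
      by_cases ha : G.Adj i j <;>
        simp [shiftedLaplacian, SimpleGraph.lapMatrix, SimpleGraph.degMatrix, hij, ha]
  rw [lapDet_eq, h, ← Matrix.charpoly]

theorem laplacianCoeff_eq_coeff (G : SimpleGraph V) {k : ℕ} (hk : k ≤ Fintype.card V) :
    laplacianCoeff G k = (lapDet G).coeff (Fintype.card V - k) := by
  classical
  rw [lapDet_eq_charpoly, Matrix.charpoly_neg_coeff, laplacianCoeff]
  have hpow : (-1 : ℤ) ^ (Fintype.card V + (Fintype.card V - k)) = (-1) ^ k := by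
    have e : Fintype.card V + (Fintype.card V - k) = 2 * (Fintype.card V - k) + k := by omega
    rw [e, pow_add, pow_mul]
    simp
  rw [hpow]

theorem lapDet_coeff_eq_zero (G : SimpleGraph V) {j : ℕ} (hj : Fintype.card V < j) :
    (lapDet G).coeff j = 0 := by
  classical
  rw [lapDet_eq_charpoly]
  exact coeff_eq_zero_of_natDegree_lt (by rwa [Matrix.charpoly_natDegree_eq_dim])

theorem LaplacianEq.lapDet_eq {G : SimpleGraph V} {H : SimpleGraph W} (h : LaplacianEq G H) :
    lapDet G = lapDet H := by
  obtain ⟨hcard, h⟩ := h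
  ext j
  rcases le_or_gt j (Fintype.card V) with hj | hj
  · have := h (Fintype.card V - j) (Nat.sub_le _ _)
    rw [laplacianCoeff_eq_coeff G (Nat.sub_le _ _),
      laplacianCoeff_eq_coeff H (hcard ▸ Nat.sub_le _ _), ← hcard, Nat.sub_sub_self hj] at this
    exact this
  · rw [lapDet_coeff_eq_zero G hj, lapDet_coeff_eq_zero H (hcard ▸ hj)]

theorem laplacianLE_of_lapDet_le {G : SimpleGraph V} {H : SimpleGraph W}
    (hcard : Fintype.card V = Fintype.card W) (h : lapDet G ≤ lapDet H) : LaplacianLE G H := by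
  refine ⟨hcard, fun k hk => ?_⟩
  rw [laplacianCoeff_eq_coeff G hk, laplacianCoeff_eq_coeff H (hcard ▸ hk), ← hcard]
  exact h _

theorem LaplacianEq.of_iso {G : SimpleGraph V} {H : SimpleGraph W} (e : G ≃g H) :
    LaplacianEq G H := by
  have hcard := Fintype.card_congr e.toEquiv
  refine ⟨hcard, fun k hk => ?_⟩
  rw [laplacianCoeff_eq_coeff G hk, laplacianCoeff_eq_coeff H (hcard ▸ hk), ← hcard,
    lapDet_iso e]

end LaplacianPolynomial

/-! ### Joining one vertex to a set of vertices of another graph -/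

section Attach

variable {V : Type v₁} {W : Type v₂}

/-- The disjoint union of `G` and `H` with the vertex `r` of `G` joined to the vertices of `H`
satisfying `N`. -/
def attach (G : SimpleGraph V) (r : V) (H : SimpleGraph W) (N : W → Prop) :
    SimpleGraph (V ⊕ W) where
  Adj x y := match x, y with
    | .inl a, .inl b => G.Adj a b
    | .inr a, .inr b => H.Adj a b
    | .inl a, .inr b => a = r ∧ N b
    | .inr a, .inl b => b = r ∧ N a
  symm := ⟨by
    rintro (a | a) (b | b) h
    · exact G.adj_symm h
    · exact h
    · exact h
    · exact H.adj_symm h⟩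
  loopless := ⟨by
    rintro (a | a) h
    · exact G.irrefl h
    · exact H.irrefl h⟩

section Adj

variable {G : SimpleGraph V} {r : V} {H : SimpleGraph W} {N : W → Prop}

@[simp] theorem attach_adj_inl_inl {a b : V} :
    (attach G r H N).Adj (.inl a) (.inl b) ↔ G.Adj a b := Iff.rfl

@[simp] theorem attach_adj_inr_inr {a b : W} :
    (attach G r H N).Adj (.inr a) (.inr b) ↔ H.Adj a b := Iff.rfl

@[simp] theorem attach_adj_inl_inr {a : V} {b : W} :
    (attach G r H N).Adj (.inl a) (.inr b) ↔ a = r ∧ N b := Iff.rfl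

@[simp] theorem attach_adj_inr_inl {a : W} {b : V} :
    (attach G r H N).Adj (.inr a) (.inl b) ↔ b = r ∧ N a := Iff.rfl

end Adj

/-- Isomorphisms of the two parts extend to the attached graphs. -/
def attachIso {V' : Type v₃} {W' : Type v₄} {G : SimpleGraph V} {G' : SimpleGraph V'}
    {H : SimpleGraph W} {H' : SimpleGraph W'} (e : G ≃g G') (f : H ≃g H') {r : V} {r' : V'}
    (hr : e r = r') {N : W → Prop} {N' : W' → Prop} (hN : ∀ w, N' (f w) ↔ N w) :
    attach G r H N ≃g attach G' r' H' N' where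
  toEquiv := Equiv.sumCongr e.toEquiv f.toEquiv
  map_rel_iff' := by
    rintro (a | a) (b | b)
    · exact e.map_adj_iff
    · exact and_congr (by rw [← hr]; exact e.injective.eq_iff) (hN b)
    · exact and_congr (by rw [← hr]; exact e.injective.eq_iff) (hN a)
    · exact f.map_adj_iff

@[simp] theorem attachIso_inl {V' : Type v₃} {W' : Type v₄} {G : SimpleGraph V}
    {G' : SimpleGraph V'} {H : SimpleGraph W} {H' : SimpleGraph W'} (e : G ≃g G') (f : H ≃g H')
    {r : V} {r' : V'} (hr : e r = r') {N : W → Prop} {N' : W' → Prop}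
    (hN : ∀ w, N' (f w) ↔ N w) (a : V) : attachIso e f hr hN (.inl a) = .inl (e a) := rfl

/-- Two attachments to the same graph commute. -/
def attachSwap {U : Type v₃} (G : SimpleGraph V) (q r : V) (H : SimpleGraph W) (N : W → Prop)
    (K : SimpleGraph U) (M : U → Prop) :
    attach (attach G q H N) (.inl r) K M ≃g attach (attach G r K M) (.inl q) H N where
  toEquiv := (Equiv.sumAssoc _ _ _).trans
    ((Equiv.sumCongr (Equiv.refl _) (Equiv.sumComm _ _)).trans (Equiv.sumAssoc _ _ _).symm)
  map_rel_iff' := by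
    rintro ((a | a) | a) ((b | b) | b) <;> simp

/-- Attaching to the attached part. -/
def attachAssoc {U : Type v₃} (G : SimpleGraph V) (r : V) (H : SimpleGraph W) (s q : W)
    (K : SimpleGraph U) (M : U → Prop) :
    attach G r (attach H q K M) (· = .inl s) ≃g
      attach (attach G r H (· = s)) (.inr q) K M where
  toEquiv := (Equiv.sumAssoc _ _ _).symm
  map_rel_iff' := by
    rintro (a | (a | a)) (b | (b | b)) <;> simp

end Attach

section Degree

variable {V : Type v₁} {W : Type v₂} [Fintype V] [Fintype W]
  (G : SimpleGraph V) (r : V) (H : SimpleGraph W) (N : W → Prop)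

open Classical in
theorem vertexDegree_attach_inl (a : V) : vertexDegree (attach G r H N) (.inl a) =
    vertexDegree G a + if a = r then (Finset.univ.filter N).card else 0 := by
  rw [vertexDegree_eq_sum, vertexDegree_eq_sum, Fintype.sum_sum_type]
  congr 1
  by_cases h : a = r <;> simp [h]

open Classical in
theorem vertexDegree_attach_inr (b : W) : vertexDegree (attach G r H N) (.inr b) =
    vertexDegree H b + if N b then 1 else 0 := by
  rw [vertexDegree_eq_sum, vertexDegree_eq_sum, Fintype.sum_sum_type, add_comm]
  congr 1
  by_cases h : N b <;> simp [h]

open Classical in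
/-- The matrix `X + L(H)` with the diagonal entries at the vertices satisfying `N` increased. -/
noncomputable def restMatrix : Matrix W W ℤ[X] :=
  shiftedLaplacian H + Matrix.diagonal fun w => if N w then 1 else 0

open Classical in
theorem shiftedLaplacian_attach : shiftedLaplacian (attach G r H N) =
    Matrix.glue (shiftedLaplacian G) r (restMatrix H N) (fun w => if N w then 1 else 0)
      ((Finset.univ.filter N).card : ℤ[X]) := by
  ext1 (a | a) (b | b)
  · by_cases hab : a = b
    · subst hab
      by_cases har : a = r
      · subst har
        simp [shiftedLaplacian, Matrix.glue, vertexDegree_attach_inl, add_assoc]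
      · simp [shiftedLaplacian, Matrix.glue, vertexDegree_attach_inl, har, Ne.symm har]
    · have : Matrix.single r r ((Finset.univ.filter N).card : ℤ[X]) a b = 0 := by
        rw [Matrix.single_apply, if_neg]
        rintro ⟨rfl, rfl⟩
        exact hab rfl
      simp [shiftedLaplacian, Matrix.glue, hab, this]
  · by_cases har : a = r <;> by_cases hb : N b <;>
      simp [shiftedLaplacian, Matrix.glue, Matrix.vecMulVec_apply, har, hb]
  · by_cases har : b = r <;> by_cases hb : N a <;>
      simp [shiftedLaplacian, Matrix.glue, Matrix.vecMulVec_apply, har, hb]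
  · by_cases hab : a = b
    · subst hab
      simp [shiftedLaplacian, Matrix.glue, restMatrix, vertexDegree_attach_inr, add_assoc]
    · simp [shiftedLaplacian, Matrix.glue, restMatrix, hab]

open Classical in
/-- The factor of `lapMinor G r` in `lapDet (attach G r H N)`. -/
noncomputable def restCoeff : ℤ[X] :=
  Matrix.glueCoeff (restMatrix H N) (fun w => if N w then 1 else 0)
    ((Finset.univ.filter N).card : ℤ[X])

open Classical in
/-- The factor of `lapDet G` in `lapDet (attach G r H N)`. -/
noncomputable def restDet : ℤ[X] := (restMatrix H N).det

theorem restMatrix_eq [DecidableEq W] [DecidablePred N] :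
    restMatrix H N = shiftedLaplacian H + Matrix.diagonal fun w => if N w then 1 else 0 := by
  unfold restMatrix; congr!

theorem restDet_eq [DecidableEq W] : restDet H N = (restMatrix H N).det := by
  unfold restDet; congr!

theorem restCoeff_eq [DecidableEq W] [DecidablePred N] : restCoeff H N =
    Matrix.glueCoeff (restMatrix H N) (fun w => if N w then 1 else 0)
      ((Finset.univ.filter N).card : ℤ[X]) := by
  unfold restCoeff; congr!

theorem restMatrix_eq_root [DecidableEq W] (s : W) :
    restMatrix H (· = s) = shiftedLaplacian H + Matrix.single s s 1 := by
  rw [restMatrix_eq]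
  congr 1
  ext1 i j
  by_cases hij : i = j
  · subst hij; simp [Matrix.single_apply, eq_comm]
  · rw [Matrix.diagonal_apply_ne _ hij, Matrix.single_apply, if_neg]
    rintro ⟨rfl, rfl⟩; exact hij rfl

variable {N H}

/-- The rooted graph enters only through its determinant and its minor at the root, so the
comparison of unicyclic graphs reduces to one of rooted trees. -/
theorem lapDet_attach (hD : restDet H N ≠ 0) : lapDet (attach G r H N) =
    lapDet G * restDet H N + lapMinor G r * restCoeff H N := by
  classical
  rw [lapDet_eq, shiftedLaplacian_attach, lapDet_eq G, lapMinor_eq G, restDet_eq, restCoeff_eq]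
  convert Matrix.det_glue (shiftedLaplacian G) r (restMatrix H N)
    (fun w => if N w then 1 else 0) _ (by rwa [← restDet_eq]) using 1

theorem lapMinor_attach : lapMinor (attach G r H N) (.inl r) = lapMinor G r * restDet H N := by
  classical
  rw [lapMinor_eq, shiftedLaplacian_attach, lapMinor_eq, restDet_eq]
  convert Matrix.adjugate_glue_apply (shiftedLaplacian G) r (restMatrix H N) _ _ using 2

theorem restDet_eq_root (s : W) : restDet H (· = s) = lapDet H + lapMinor H s := by
  classical
  rw [restDet_eq, restMatrix_eq_root, lapDet_eq, lapMinor_eq, Matrix.det_add_single, one_mul]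

end Degree

section Rest

variable {W : Type v₂} [Fintype W] (H : SimpleGraph W) (N : W → Prop)

/-- For a single joining edge the subtracted term is the minor at `s`, which cancels the one in
`restDet_eq_root`. With this, `lapDet_attach` becomes the rule behind `plant`. -/
theorem restCoeff_eq_root (s : W) : restCoeff H (· = s) = lapDet H := by
  classical
  have hn : (fun w : W => if w = s then (1 : ℤ[X]) else 0) = Pi.single s 1 := by
    ext1 w; simp [Pi.single_apply]
  have hadj : (restMatrix H (· = s)).adjugate s s = lapMinor H s := by
    rw [lapMinor_eq, Matrix.adjugate_apply, Matrix.adjugate_apply, restMatrix_eq_root]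
    congr 1
    ext1 i j
    by_cases hi : i = s
    · subst hi; simp
    · simp [Matrix.updateRow_apply, hi, Ne.symm hi]
  have hc : ((Finset.univ.filter (· = s)).card : ℤ[X]) = 1 := by
    rw [show Finset.univ.filter (· = s) = {s} by ext; simp]
    simp
  rw [restCoeff_eq, hn, hc, Matrix.glueCoeff, one_mul, ← restDet_eq, restDet_eq_root,
    single_one_dotProduct, Matrix.mulVec_single_one, Matrix.col_apply, hadj, add_sub_cancel_right]

open Classical in
/-- The integer matrix `M` with `restMatrix H N = X + M`. -/
noncomputable def restIntMatrix : Matrix W W ℤ :=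
  H.lapMatrix ℤ + Matrix.diagonal fun w => if N w then 1 else 0

open Classical in
theorem restMatrix_eq_charmatrix : restMatrix H N = (-(restIntMatrix H N)).charmatrix := by
  ext1 i j
  by_cases hij : i = j
  · subst hij
    by_cases hN : N i
    · simp [restMatrix, restIntMatrix, shiftedLaplacian, Matrix.charmatrix_apply_eq,
        SimpleGraph.lapMatrix, SimpleGraph.degMatrix, vertexDegree, hN]
      ring
    · simp [restMatrix, restIntMatrix, shiftedLaplacian, Matrix.charmatrix_apply_eq,
        SimpleGraph.lapMatrix, SimpleGraph.degMatrix, vertexDegree, hN]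
  · rw [Matrix.charmatrix_apply_ne _ _ _ hij]
    by_cases ha : H.Adj i j <;>
      simp [restMatrix, restIntMatrix, shiftedLaplacian, SimpleGraph.lapMatrix,
        SimpleGraph.degMatrix, hij, ha]

theorem restDet_monic : (restDet H N).Monic := by
  classical
  rw [restDet_eq, restMatrix_eq_charmatrix]
  exact Matrix.charpoly_monic (-(restIntMatrix H N))

theorem restDet_ne_zero : restDet H N ≠ 0 := (restDet_monic H N).ne_zero

theorem restMatrix_offDiag_nonpos {i j : W} (hij : i ≠ j) : restMatrix H N i j ≤ 0 := by
  classical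
  rw [restMatrix, Matrix.add_apply, Matrix.diagonal_apply_ne _ hij, add_zero, shiftedLaplacian,
    Matrix.of_apply, if_neg hij]
  split_ifs
  · exact neg_nonpos.2 zero_le_one
  · exact le_rfl

open Classical in
theorem sum_restMatrix (i : W) :
    ∑ j, restMatrix H N i j = X + if N i then 1 else 0 := by
  have h1 : ∀ j, shiftedLaplacian H i j =
      (if i = j then X + (vertexDegree H i : ℤ[X]) else 0) - if H.Adj i j then 1 else 0 := by
    intro j
    by_cases hij : i = j
    · subst hij; simp [shiftedLaplacian]
    · by_cases ha : H.Adj i j <;> simp [shiftedLaplacian, hij, ha]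
  simp only [restMatrix, Matrix.add_apply, Finset.sum_add_distrib, h1, Finset.sum_sub_distrib,
    Matrix.diagonal_apply, Finset.sum_ite_eq, Finset.mem_univ, if_true]
  rw [vertexDegree_eq_sum]
  push_cast
  ring

theorem restDet_nonneg : 0 ≤ restDet H N := by
  classical
  rw [restDet_eq]
  refine Matrix.det_nonneg_of_offDiag_nonpos _
    (fun i j hij => restMatrix_offDiag_nonpos H N hij) fun i => ?_
  rw [sum_restMatrix]
  refine add_nonneg intPolynomial_X_pos.le ?_
  split_ifs
  · exact zero_le_one
  · exact le_rfl

/-- It is itself a determinant: that of X + L for one new vertex joined to `H`, with the X at that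
vertex dropped. The new row has sum zero, so the nonnegativity criterion still applies. -/
theorem restCoeff_nonneg : 0 ≤ restCoeff H N := by
  classical
  have h := Matrix.det_glue_zero_unit (restMatrix H N) (fun w => if N w then 1 else 0)
    ((Finset.univ.filter N).card : ℤ[X]) (by rw [← restDet_eq]; exact restDet_ne_zero H N)
  rw [restCoeff_eq, ← h]
  have hle : ∀ w, (0 : ℤ[X]) ≤ if N w then 1 else 0 := by
    intro w
    split_ifs
    · exact zero_le_one
    · exact le_rfl
  refine Matrix.det_nonneg_of_offDiag_nonpos _ ?_ ?_
  · rintro (i | i) (j | j) hij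
    · exact absurd rfl hij
    · simpa [Matrix.glue, Matrix.vecMulVec_apply] using hle j
    · simpa [Matrix.glue, Matrix.vecMulVec_apply] using hle i
    · exact restMatrix_offDiag_nonpos H N (by simpa using hij)
  · rintro (i | i)
    · simp [Matrix.glue, Matrix.vecMulVec_apply]
    · have := sum_restMatrix H N i
      simp only [Fintype.sum_sum_type, Matrix.glue, Matrix.fromBlocks_apply₂₁,
        Matrix.fromBlocks_apply₂₂, this]
      simpa [Matrix.vecMulVec_apply] using intPolynomial_X_pos.le

/-- If it vanished, det(X + L) of `H` with one vertex attached would be X times `restDet`. Comparing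
second-highest coefficients compares traces, and these differ by the degree of the new vertex. -/
theorem restCoeff_ne_zero (hN : ∃ w, N w) : restCoeff H N ≠ 0 := by
  classical
  intro h0
  have h := lapDet_attach (⊥ : SimpleGraph Unit) () (restDet_ne_zero H N)
  have hunit : lapDet (⊥ : SimpleGraph Unit) = X := by
    rw [lapDet_eq, Matrix.det_unique]
    simp [shiftedLaplacian, vertexDegree]
  rw [h0, mul_zero, add_zero, hunit, lapDet_eq_charpoly, restDet_eq,
    restMatrix_eq_charmatrix, ← Matrix.charpoly] at h
  have h2 := congrArg Polynomial.nextCoeff h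
  rw [monic_X.nextCoeff_mul (Matrix.charpoly_monic _)] at h2
  have hX : (X : ℤ[X]).nextCoeff = 0 := by simpa using nextCoeff_X_sub_C (0 : ℤ)
  rw [hX, zero_add, ← neg_inj, ← Matrix.trace_eq_neg_charpoly_nextCoeff,
    ← Matrix.trace_eq_neg_charpoly_nextCoeff, Matrix.trace_neg, Matrix.trace_neg, neg_inj] at h2
  have hdeg : ∀ u : W, H.lapMatrix ℤ u u = vertexDegree H u := by
    intro u
    simp [SimpleGraph.lapMatrix, SimpleGraph.degMatrix, vertexDegree]
  have hdeg' : ∀ u : Unit ⊕ W, (attach (⊥ : SimpleGraph Unit) () H N).lapMatrix ℤ u u =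
      vertexDegree (attach (⊥ : SimpleGraph Unit) () H N) u := by
    intro u
    simp [SimpleGraph.lapMatrix, SimpleGraph.degMatrix, vertexDegree]
  simp only [Matrix.trace, Matrix.diag_apply, hdeg', Fintype.sum_sum_type, restIntMatrix,
    vertexDegree_attach_inl, vertexDegree_attach_inr, Matrix.add_apply,
    Matrix.diagonal_apply_eq, hdeg] at h2
  obtain ⟨w, hw⟩ := hN
  simp [vertexDegree] at h2
  exact h2 hw

end Rest

/-! ### Leaf counts, and trees as plane trees -/

open Classical in
/-- The number of vertices of degree one different from `r`. -/
noncomputable def nonrootLeaves {V : Type*} [Fintype V] (G : SimpleGraph V) (r : V) : ℕ :=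
  ∑ v, if v ≠ r ∧ vertexDegree G v = 1 then 1 else 0

theorem nonrootLeaves_iso {V W : Type*} [Fintype V] [Fintype W] {G : SimpleGraph V}
    {H : SimpleGraph W} (e : G ≃g H) (r : V) : nonrootLeaves H (e r) = nonrootLeaves G r := by
  classical
  rw [nonrootLeaves, nonrootLeaves, ← Equiv.sum_comp e.toEquiv]
  refine Finset.sum_congr rfl fun w _ => ?_
  exact if_congr (and_congr (not_congr e.injective.eq_iff)
    (by rw [← vertexDegree_iso e w]; rfl)) rfl rfl

open Classical in
theorem nonrootLeaves_attach {V W : Type*} [Fintype V] [Fintype W] (G : SimpleGraph V) (r : V)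
    (H : SimpleGraph W) (N : W → Prop) : nonrootLeaves (attach G r H N) (.inl r) =
      nonrootLeaves G r +
        ∑ w, if vertexDegree H w + (if N w then 1 else 0) = 1 then 1 else 0 := by
  rw [nonrootLeaves, Fintype.sum_sum_type]
  congr 1
  · refine Finset.sum_congr rfl fun v _ => ?_
    rw [vertexDegree_attach_inl]
    by_cases hv : v = r <;> simp [hv]
  · refine Finset.sum_congr rfl fun w _ => ?_
    rw [vertexDegree_attach_inr]
    simp

namespace PlaneTree

/-- The vertices of a plane tree. -/
def Vert : PlaneTree → Type
  | nil => Unit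
  | cons b r => r.Vert ⊕ b.Vert

instance instFintypeVert : (t : PlaneTree) → Fintype t.Vert
  | nil => inferInstanceAs (Fintype Unit)
  | cons b r =>
    letI := instFintypeVert b
    letI := instFintypeVert r
    inferInstanceAs (Fintype (r.Vert ⊕ b.Vert))

/-- The root of a plane tree. -/
def root : (t : PlaneTree) → t.Vert
  | nil => ()
  | cons _ r => Sum.inl r.root

/-- The underlying graph of a plane tree. -/
def graph : (t : PlaneTree) → SimpleGraph t.Vert
  | nil => ⊥
  | cons b r => attach r.graph r.root b.graph (· = b.root)

/-- This is the dictionary between graphs and dual numbers: the recursion of `attach` along one edge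
agrees with planting and multiplying. -/
theorem lapMinor_lapDet_graph (t : PlaneTree) :
    lapMinor t.graph t.root = (t.pair (X : ℤ[X])).fst ∧
      lapDet t.graph = pairTotal X (t.pair (X : ℤ[X])) := by
  classical
  induction t with
  | nil =>
    constructor
    · change lapMinor (⊥ : SimpleGraph Unit) () = _
      rw [lapMinor_eq, Matrix.adjugate_subsingleton]
      simp [pair]
    · change lapDet (⊥ : SimpleGraph Unit) = _
      rw [lapDet_eq, Matrix.det_unique]
      simp [shiftedLaplacian, vertexDegree, pair, pairTotal]
  | cons b r hb hr =>
    have hD := restDet_eq_root (H := b.graph) b.root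
    have h1 : lapMinor (cons b r).graph (cons b r).root =
        lapMinor r.graph r.root * restDet b.graph (· = b.root) :=
      lapMinor_attach r.graph r.root
    have h2 : lapDet (cons b r).graph = lapDet r.graph * restDet b.graph (· = b.root) +
        lapMinor r.graph r.root * restCoeff b.graph (· = b.root) :=
      lapDet_attach r.graph r.root (restDet_ne_zero _ _)
    rw [h1, h2, restCoeff_eq_root, hD, hb.1, hb.2, hr.1, hr.2, pair, mul_comm (plant _ _),
      pairTotal_mul]
    simp only [TrivSqZeroExt.fst_mul, fst_plant, pairTotal, snd_plant]
    exact ⟨by ring, by ring⟩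

theorem card_vert (t : PlaneTree) : Fintype.card t.Vert = t.edges + 1 := by
  induction t with
  | nil => rfl
  | cons b r hb hr =>
    have : Fintype.card (cons b r).Vert = Fintype.card r.Vert + Fintype.card b.Vert :=
      Fintype.card_sum
    rw [this, hb, hr, edges]; ring

theorem vertexDegree_root (t : PlaneTree) : vertexDegree t.graph t.root = t.children := by
  classical
  induction t with
  | nil =>
    change vertexDegree (⊥ : SimpleGraph Unit) () = _
    simp [vertexDegree, children]
  | cons b r hb hr =>
    have : vertexDegree (cons b r).graph (cons b r).root = _ :=
      vertexDegree_attach_inl r.graph r.root b.graph (· = b.root) r.root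
    rw [this, hr, children, if_pos rfl, show Finset.univ.filter (· = b.root) = {b.root} by ext; simp]
    simp

theorem nonrootLeaves_graph (t : PlaneTree) : nonrootLeaves t.graph t.root = t.leaves := by
  classical
  induction t with
  | nil =>
    change nonrootLeaves (⊥ : SimpleGraph Unit) () = _
    simp [nonrootLeaves, leaves]
  | cons b r hb hr =>
    have h : nonrootLeaves (cons b r).graph (cons b r).root = _ :=
      nonrootLeaves_attach r.graph r.root b.graph (· = b.root)
    rw [h, hr, leaves_cons, add_comm]
    congr 1
    have hroot := vertexDegree_root b
    -- The root of `b` gains one edge, so it becomes a leaf exactly when `b` is a single vertex.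
    cases b with
    | nil =>
      have : ∀ v : nil.Vert, v = nil.root := fun _ => rfl
      simp only [this, hroot]
      simp [branchLeaves, children]
      rfl
    | cons c s =>
      rw [branchLeaves, ← hb, nonrootLeaves]
      refine Finset.sum_congr rfl fun v _ => ?_
      by_cases hv : v = (cons c s).root
      · subst hv
        simp [hroot, children]
      · simp [hv]

theorem one_le_branchLeaves (t : PlaneTree) : 1 ≤ t.branchLeaves := by
  induction t with
  | nil => rfl
  | cons b r hb _ => rw [branchLeaves, leaves_cons]; omega

theorem branchLeaves_le (t : PlaneTree) : t.branchLeaves ≤ t.edges + 1 ∧ t.leaves ≤ t.edges := by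
  induction t with
  | nil => simp [branchLeaves, leaves, edges]
  | cons b r hb hr => rw [branchLeaves, leaves_cons, edges]; omega

theorem leaves_pos {t : PlaneTree} (ht : 0 < t.children) : 0 < t.leaves := by
  cases t with
  | nil => simp [children] at ht
  | cons b r => have := one_le_branchLeaves b; rw [leaves_cons]; omega

/-- Adding a pendant vertex to a plane tree gives a plane tree. -/
theorem exists_attach_iso (t : PlaneTree) (p : t.Vert) :
    ∃ (t' : PlaneTree) (e : t'.graph ≃g attach t.graph p (⊥ : SimpleGraph Unit) fun _ => True),
      e t'.root = Sum.inl t.root := by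
  induction t with
  | nil =>
    refine ⟨cons nil nil, attachIso SimpleGraph.Iso.refl SimpleGraph.Iso.refl rfl ?_, rfl⟩
    intro w
    exact ⟨fun _ => rfl, fun _ => trivial⟩
  | cons b r hb hr =>
    rcases p with p | p
    · obtain ⟨r', e, he⟩ := hr p
      refine ⟨cons b r', (attachIso e SimpleGraph.Iso.refl he fun _ => Iff.rfl).trans
        (attachSwap r.graph p r.root ⊥ (fun _ => True) b.graph (· = b.root)), ?_⟩
      exact congrArg (attachSwap r.graph p r.root (⊥ : SimpleGraph Unit)
        (fun _ => True) b.graph (· = b.root)) (congrArg Sum.inl he)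
    · obtain ⟨b', e, he⟩ := hb p
      refine ⟨cons b' r, (attachIso SimpleGraph.Iso.refl e rfl fun w => ?_).trans
        (attachAssoc _ _ _ _ _ _ _), rfl⟩
      rw [← he]
      exact e.injective.eq_iff

end PlaneTree

theorem SimpleGraph.IsTree.exists_planeTree {V : Type v₁} [Fintype V] {G : SimpleGraph V}
    (hG : G.IsTree) (r : V) : ∃ (t : PlaneTree) (e : t.graph ≃g G), e t.root = r := by
  classical
  induction hn : Fintype.card V using Nat.strong_induction_on generalizing V with
  | _ n ih =>
  cases subsingleton_or_nontrivial V with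
  | inl hs =>
    refine ⟨.nil, ⟨⟨fun _ => r, fun _ => (), fun _ => rfl, fun _ => Subsingleton.elim _ _⟩, ?_⟩, rfl⟩
    intro a b
    exact ⟨fun h => absurd (Subsingleton.elim _ _) h.ne, fun h => absurd rfl h.ne⟩
  | inr hnt =>
    have split : ∀ v, G.degree v = 1 → ∃ p : ({v}ᶜ : Set V), (G.induce {v}ᶜ).IsTree ∧
        Fintype.card ({v}ᶜ : Set V) < n ∧
        ∃ e : attach (G.induce {v}ᶜ) p (⊥ : SimpleGraph Unit) (fun _ => True) ≃g G,
          ∀ a, e (Sum.inl a) = a := by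
      intro v hv
      obtain ⟨p, hp, huniq⟩ := SimpleGraph.degree_eq_one_iff_existsUnique_adj.1 hv
      refine ⟨⟨p, hp.ne'⟩, ⟨hG.connected.induce_compl_singleton_of_degree_eq_one hv,
        hG.isAcyclic.induce _⟩, ?_, ?_⟩
      · rw [← hn]
        exact Fintype.card_subtype_lt (x := v) (by simp)
      · let f : ({v}ᶜ : Set V) ⊕ Unit → V := Sum.elim Subtype.val fun _ => v
        have hf : Function.Bijective f := by
          constructor
          · rintro (⟨a, ha⟩ | a) (⟨b, hb⟩ | b) h
            · simpa [f] using h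
            · exact absurd h ha
            · exact absurd h.symm hb
            · rfl
          · intro a
            by_cases ha : a = v
            · exact ⟨Sum.inr (), ha.symm⟩
            · exact ⟨Sum.inl ⟨a, ha⟩, rfl⟩
        have hadj : ∀ a : ({v}ᶜ : Set V), G.Adj a v ↔ a = ⟨p, hp.ne'⟩ := by
          intro a
          refine ⟨fun h => Subtype.ext (huniq a h.symm), ?_⟩
          rintro rfl
          exact hp.symm
        refine ⟨⟨Equiv.ofBijective f hf, ?_⟩, fun a => rfl⟩
        rintro (a | a) (b | b)
        · exact Iff.rfl
        · exact (hadj a).trans (and_iff_left trivial).symm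
        · exact (G.adj_comm _ _).trans ((hadj b).trans (and_iff_left trivial).symm)
        · exact ⟨fun h => absurd rfl h.ne, fun h => absurd rfl h.ne⟩
    -- A nontrivial tree has two leaves, so one can be removed without losing the prescribed root.
    obtain ⟨v, hv, hr⟩ : ∃ v, G.degree v = 1 ∧ r ≠ v := by
      obtain ⟨u, v, huv, hu, hv⟩ := hG.exists_ne_and_degree_eq_one
      by_cases h : r = u
      · exact ⟨v, hv, fun h' => huv (h.symm.trans h')⟩
      · exact ⟨u, hu, h⟩
    obtain ⟨p, htree, hlt, e, he⟩ := split v hv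
    obtain ⟨t, f, hf⟩ := ih _ hlt htree ⟨r, hr⟩ rfl
    obtain ⟨t', f', hf'⟩ := t.exists_attach_iso (f.symm p)
    refine ⟨t', (f'.trans (attachIso f SimpleGraph.Iso.refl (by simp) fun _ => Iff.rfl)).trans e,
      ?_⟩
    change e (attachIso f SimpleGraph.Iso.refl _ _ (f' t'.root)) = r
    rw [hf', attachIso_inl, hf, he]

namespace PlaneTree

theorem exists_starlike_iso_of_perm {l l' : List ℕ} (h : l.Perm l') :
    ∃ e : (starlike l).graph ≃g (starlike l').graph, e (starlike l).root = (starlike l').root := by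
  induction h with
  | nil => exact ⟨SimpleGraph.Iso.refl, rfl⟩
  | cons a _ ih =>
    obtain ⟨e, he⟩ := ih
    exact ⟨attachIso e SimpleGraph.Iso.refl he fun _ => Iff.rfl, congrArg Sum.inl he⟩
  | swap a b l =>
    exact ⟨attachSwap (starlike l).graph (starlike l).root (starlike l).root (path a).graph
      (· = (path a).root) (path b).graph (· = (path b).root), rfl⟩
  | trans _ _ ih ih' =>
    obtain ⟨e, he⟩ := ih
    obtain ⟨e', he'⟩ := ih'
    exact ⟨e.trans e', (congrArg e' he).trans he'⟩

theorem exists_path_iso (a : ℕ) :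
    ∃ e : (path a).graph ≃g SimpleGraph.pathGraph (a + 1), e (path a).root = 0 := by
  induction a with
  | zero =>
    refine ⟨⟨⟨fun _ => 0, fun _ => (), fun _ => rfl, fun x => (Fin.fin_one_eq_zero x).symm⟩, ?_⟩, rfl⟩
    intro x y
    exact ⟨fun h => absurd ((Fin.fin_one_eq_zero _).trans (Fin.fin_one_eq_zero _).symm) h.ne, fun h => absurd rfl h.ne⟩
  | succ a ih =>
    obtain ⟨e, he⟩ := ih
    let f : Unit ⊕ Fin (a + 1) → Fin (a + 2) := Sum.elim (fun _ => 0) Fin.succ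
    have hf : Function.Bijective f := by
      constructor
      · rintro (x | x) (y | y) h
        · rfl
        · exact absurd h.symm (Fin.succ_ne_zero y)
        · exact absurd h (Fin.succ_ne_zero x)
        · exact congrArg _ (Fin.succ_injective _ h)
      · intro x
        cases x using Fin.cases with
        | zero => exact ⟨Sum.inl (), rfl⟩
        | succ x => exact ⟨Sum.inr x, rfl⟩
    let E : attach (⊥ : SimpleGraph Unit) () (SimpleGraph.pathGraph (a + 1)) (· = 0) ≃g
        SimpleGraph.pathGraph (a + 2) := by
      refine ⟨Equiv.ofBijective f hf, ?_⟩
      rintro (x | x) (y | y)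
      · simp [f]
      · simp [f, SimpleGraph.pathGraph_adj]
      · simp [f, SimpleGraph.pathGraph_adj]
      · simp [f, SimpleGraph.pathGraph_adj]
    have hN : ∀ w, e w = 0 ↔ w = (path a).root := by
      intro w
      rw [← he]
      exact e.injective.eq_iff
    exact ⟨(attachIso (G := (⊥ : SimpleGraph Unit)) (r := ()) (N := (· = (path a).root))
      SimpleGraph.Iso.refl e rfl hN).trans E, rfl⟩

end PlaneTree

/-! ### Starlike trees given by their leg lengths -/

/-- The starlike tree with leg lengths `f`, centered at `none`. -/
def legsGraph {l : ℕ} (f : Fin l → ℕ) : SimpleGraph (Option (Σ j : Fin l, Fin (f j))) :=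
  SimpleGraph.fromRel fun x y => match x, y with
    | none, some ⟨_, b⟩ => (b : ℕ) = 0
    | some ⟨i, a⟩, some ⟨j, b⟩ => i = j ∧ (a : ℕ) + 1 = b
    | _, _ => False

theorem exists_legsGraph_iso {l : ℕ} (f : Fin l → ℕ) :
    ∃ e : (PlaneTree.starlike (List.ofFn f)).graph ≃g legsGraph (fun j => f j + 1),
      e (PlaneTree.starlike (List.ofFn f)).root = none := by
  induction l with
  | zero =>
    have : ∀ x : Option (Σ j : Fin 0, Fin (f j + 1)), none = x := by
      rintro (_ | ⟨j, _⟩)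
      · rfl
      · exact j.elim0
    refine ⟨⟨⟨fun _ => none, fun _ => (), fun _ => rfl, this⟩, ?_⟩, rfl⟩
    intro x y
    exact ⟨fun h => absurd rfl h.ne, fun h => absurd rfl h.ne⟩
  | succ l ih =>
    rw [List.ofFn_succ]
    obtain ⟨e, he⟩ := ih fun j => f j.succ
    obtain ⟨p, hp⟩ := PlaneTree.exists_path_iso (f 0)
    let φ : Option (Σ j : Fin l, Fin (f j.succ + 1)) ⊕ Fin (f 0 + 1) →
        Option (Σ j : Fin (l + 1), Fin (f j + 1)) :=
      Sum.elim (Option.map fun x => ⟨x.1.succ, x.2⟩) fun a => some ⟨0, a⟩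
    have hφ : Function.Bijective φ := by
      constructor
      · rintro ((_ | ⟨i, a⟩) | a) ((_ | ⟨j, b⟩) | b) h
        · rfl
        · simp [φ] at h
        · simp [φ] at h
        · simp [φ] at h
        · simp only [φ, Sum.elim_inl, Option.map_some, Option.some.injEq, Sigma.mk.injEq] at h
          obtain ⟨h1, h2⟩ := h
          obtain rfl := Fin.succ_injective _ h1
          obtain rfl := eq_of_heq h2
          rfl
        · simp only [φ, Sum.elim_inl, Sum.elim_inr, Option.map_some, Option.some.injEq,
            Sigma.mk.injEq] at h
          exact absurd h.1 (Fin.succ_ne_zero i)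
        · simp [φ] at h
        · simp only [φ, Sum.elim_inl, Sum.elim_inr, Option.map_some, Option.some.injEq,
            Sigma.mk.injEq] at h
          exact absurd h.1.symm (Fin.succ_ne_zero j)
        · simp only [φ, Sum.elim_inr, Option.some.injEq, Sigma.mk.injEq, heq_eq_eq] at h
          rw [h.2]
      · rintro (_ | ⟨j, a⟩)
        · exact ⟨Sum.inl none, rfl⟩
        · cases j using Fin.cases with
          | zero => exact ⟨Sum.inr a, rfl⟩
          | succ j => exact ⟨Sum.inl (some ⟨j, a⟩), rfl⟩
    let E : attach (legsGraph fun j => f j.succ + 1) none (SimpleGraph.pathGraph (f 0 + 1))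
        (· = 0) ≃g legsGraph (fun j => f j + 1) := by
      refine ⟨Equiv.ofBijective φ hφ, ?_⟩
      rintro ((_ | ⟨i, a⟩) | a) ((_ | ⟨j, b⟩) | b)
      · simp [φ, legsGraph]
      · simp [φ, legsGraph]
      · simp [φ, legsGraph]
      · simp [φ, legsGraph]
      · by_cases hij : i = j
        · subst hij
          simp [φ, legsGraph]
        · simp [φ, legsGraph, hij, Ne.symm hij]
      · simp [φ, legsGraph, Fin.succ_ne_zero, (Fin.succ_ne_zero _).symm]
      · simp [φ, legsGraph]
      · simp [φ, legsGraph, Fin.succ_ne_zero, (Fin.succ_ne_zero _).symm]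
      · simp [φ, legsGraph, SimpleGraph.pathGraph_adj]
        omega
    have hN : ∀ w, p w = 0 ↔ w = (PlaneTree.path (f 0)).root := by
      intro w
      rw [← hp]
      exact p.injective.eq_iff
    refine ⟨(attachIso e p he hN).trans E, ?_⟩
    exact congrArg E (congrArg Sum.inl he)

/-! ### The cycle cut at one vertex -/

section Cycle

/-- The cycle with the vertex `o` removed. -/
def cycleRest {g : ℕ} (o : Fin g) : SimpleGraph {i : Fin g // i ≠ o} :=
  (SimpleGraph.cycleGraph g).comap Subtype.val

/-- The neighbors of the removed vertex `o`. -/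
def cycleNbr {g : ℕ} (o : Fin g) (i : {i : Fin g // i ≠ o}) : Prop :=
  (SimpleGraph.cycleGraph g).Adj o i

theorem exists_cycleAttach_iso {g : ℕ} (o : Fin g) (T : Fin g → RootedGraph.{v₁})
    (hT : ∀ i, i ≠ o → Fintype.card (T i).V = 1) :
    ∃ e : attach (T o).graph (T o).root (cycleRest o) (cycleNbr o) ≃g cycleAttach T,
      ∀ a, e (Sum.inl a) = ⟨o, a⟩ := by
  have hsub : ∀ i, i ≠ o → Subsingleton (T i).V := fun i hi =>
    Fintype.card_le_one_iff_subsingleton.1 (hT i hi).le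
  let f : (T o).V ⊕ {i : Fin g // i ≠ o} → Σ i, (T i).V :=
    Sum.elim (fun a => ⟨o, a⟩) fun i => ⟨i, (T i).root⟩
  have hf : Function.Bijective f := by
    constructor
    · rintro (a | ⟨i, hi⟩) (b | ⟨j, hj⟩) h
      · simp only [f, Sum.elim_inl, Sigma.mk.injEq, heq_eq_eq, true_and] at h
        rw [h]
      · exact absurd (congrArg Sigma.fst h).symm hj
      · exact absurd (congrArg Sigma.fst h) hi
      · have : i = j := congrArg Sigma.fst h
        subst this
        rfl
    · rintro ⟨i, a⟩
      by_cases hi : i = o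
      · subst hi
        exact ⟨Sum.inl a, rfl⟩
      · have := hsub i hi
        exact ⟨Sum.inr ⟨i, hi⟩, by simp [f, eq_iff_true_of_subsingleton]⟩
  have htree : ∀ i, i ≠ o → ∀ a b : (T i).V, ¬(T i).graph.Adj a b := fun i hi a b h =>
    h.ne ((hsub i hi).elim a b)
  have hroots : ∀ (i j : Fin g) (a : (T i).V) (b : (T j).V), i ≠ j →
      ((cycleAttach T).Adj ⟨i, a⟩ ⟨j, b⟩ ↔
        (SimpleGraph.cycleGraph g).Adj i j ∧ a = (T i).root ∧ b = (T j).root) := by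
    intro i j a b hij
    constructor
    · rintro (⟨k, a', b', -, h1, h2⟩ | ⟨i', j', h, h1, h2⟩)
      · exact absurd ((congrArg Sigma.fst h1).trans (congrArg Sigma.fst h2).symm) hij
      · obtain rfl : i = i' := congrArg Sigma.fst h1
        obtain rfl : j = j' := congrArg Sigma.fst h2
        exact ⟨h, by simpa using h1, by simpa using h2⟩
    · rintro ⟨h, rfl, rfl⟩
      exact Or.inr ⟨i, j, h, rfl, rfl⟩
  have hsame : ∀ (i : Fin g) (a b : (T i).V),
      (cycleAttach T).Adj ⟨i, a⟩ ⟨i, b⟩ ↔ (T i).graph.Adj a b := by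
    intro i a b
    constructor
    · rintro (⟨k, a', b', h, h1, h2⟩ | ⟨i', j', h, h1, h2⟩)
      · obtain rfl : i = k := congrArg Sigma.fst h1
        obtain rfl : a = a' := by simpa using h1
        obtain rfl : b = b' := by simpa using h2
        exact h
      · have e1 : i = i' := congrArg Sigma.fst h1
        have e2 : i = j' := congrArg Sigma.fst h2
        exact absurd (e1.symm.trans e2) h.ne
    · intro h
      exact Or.inl ⟨i, a, b, h, rfl, rfl⟩
  refine ⟨⟨Equiv.ofBijective f hf, ?_⟩, fun a => rfl⟩
  rintro (a | ⟨i, hi⟩) (b | ⟨j, hj⟩)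
  · exact hsame o a b
  · refine (hroots o j a (T j).root hj.symm).trans ?_
    simp [cycleNbr, and_comm]
  · refine (hroots i o (T i).root b hi).trans ?_
    simp [cycleNbr, and_comm, SimpleGraph.adj_comm]
  · change (cycleAttach T).Adj ⟨i, (T i).root⟩ ⟨j, (T j).root⟩ ↔
      (SimpleGraph.cycleGraph g).Adj i j
    by_cases hij : i = j
    · subst hij
      exact ⟨fun h => absurd rfl h.ne, fun h => absurd rfl h.ne⟩
    · refine (hroots i j _ _ hij).trans ?_
      simp

theorem vertexDegree_cycleGraph {g : ℕ} (hg : 3 ≤ g) (i : Fin g) :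
    vertexDegree (SimpleGraph.cycleGraph g) i = 2 := by
  obtain ⟨k, rfl⟩ := Nat.exists_eq_add_of_le' hg
  rw [vertexDegree, ← SimpleGraph.cycleGraph_degree_three_le (v := i)]
  congr!

open Classical in
theorem card_cycleNbr {g : ℕ} (hg : 3 ≤ g) (o : Fin g) :
    (Finset.univ.filter (cycleNbr o)).card = 2 := by
  rw [← vertexDegree_cycleGraph hg o, vertexDegree_eq_sum, Finset.card_filter,
    Fintype.sum_eq_add_sum_subtype_ne _ o]
  simp [cycleNbr]
  congr!

open Classical in
theorem vertexDegree_cycleRest {g : ℕ} (hg : 3 ≤ g) (o : Fin g) (i : {i : Fin g // i ≠ o}) :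
    vertexDegree (cycleRest o) i + (if cycleNbr o i then 1 else 0) = 2 := by
  rw [← vertexDegree_cycleGraph hg (i : Fin g), vertexDegree_eq_sum, vertexDegree_eq_sum,
    Fintype.sum_eq_add_sum_subtype_ne _ o, add_comm]
  congr 1
  by_cases h : (SimpleGraph.cycleGraph g).Adj o i
  · simp [cycleNbr, h, h.symm]
  · simp [cycleNbr, h, mt SimpleGraph.Adj.symm h]

variable {V : Type v₁} [Fintype V]

theorem vertexDegree_attach_cycle {g : ℕ} (hg : 3 ≤ g) (o : Fin g) (G : SimpleGraph V) (r : V) :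
    vertexDegree (attach G r (cycleRest o) (cycleNbr o)) (.inl r) = vertexDegree G r + 2 := by
  rw [vertexDegree_attach_inl, if_pos rfl, card_cycleNbr hg]

theorem leafCount_iso {V W : Type*} [Fintype V] [Fintype W] {G : SimpleGraph V}
    {H : SimpleGraph W} (e : G ≃g H) : leafCount G = leafCount H := by
  rw [leafCount, leafCount]
  refine Set.ncard_congr (fun a _ => e a) (fun a ha => ?_) (fun a b _ _ h => e.injective h) ?_
  · exact (vertexDegree_iso e a).trans ha
  · intro b hb
    refine ⟨e.symm b, ?_, by simp⟩
    have := vertexDegree_iso e (e.symm b)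
    simp only [RelIso.apply_symm_apply] at this
    exact this.symm.trans hb

theorem leafCount_eq_nonrootLeaves (G : SimpleGraph V) (r : V) (hr : vertexDegree G r ≠ 1) :
    leafCount G = nonrootLeaves G r := by
  classical
  rw [leafCount, nonrootLeaves, ← Finset.card_filter, ← Set.ncard_coe_finset]
  congr 1
  ext v
  simp only [Set.mem_ofPred_eq, Finset.coe_filter, Finset.mem_univ, true_and]
  refine ⟨fun h => ⟨?_, h⟩, fun h => h.2⟩
  rintro rfl
  exact hr h

/-- The other cycle vertices have degree 2 and the root at least 2, so every leaf is a nonroot leaf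
of the attached graph. -/
theorem leafCount_attach_cycle {g : ℕ} (hg : 3 ≤ g) (o : Fin g) (G : SimpleGraph V) (r : V) :
    leafCount (attach G r (cycleRest o) (cycleNbr o)) = nonrootLeaves G r := by
  classical
  rw [leafCount_eq_nonrootLeaves _ (.inl r) (by rw [vertexDegree_attach_cycle hg]; omega),
    nonrootLeaves_attach]
  simp [vertexDegree_cycleRest hg]

theorem card_cycleRest {g : ℕ} (o : Fin g) : Fintype.card {i : Fin g // i ≠ o} = g - 1 := by
  simp

theorem exists_cycleNbr {g : ℕ} (hg : 3 ≤ g) (o : Fin g) : ∃ i, cycleNbr o i := by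
  classical
  have h := card_cycleNbr hg o
  obtain ⟨i, hi⟩ := Finset.card_pos.1 (h.symm ▸ two_pos :
    0 < (Finset.univ.filter (cycleNbr o)).card)
  exact ⟨i, (Finset.mem_filter.1 hi).2⟩

end Cycle

/-! ### Comparison through the cycle and conclusion -/

/-- Comparing graphs with the same attached part through the rooted parts. -/
theorem lapDet_attach_le {V V' W : Type*} [Fintype V] [Fintype V'] [Fintype W]
    {G : SimpleGraph V} {r : V} {G' : SimpleGraph V'} {r' : V'} {H : SimpleGraph W}
    {N : W → Prop} (hN : ∃ w, N w) (h1 : lapMinor G r ≤ lapMinor G' r')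
    (h2 : lapDet G ≤ lapDet G') :
    lapDet (attach G r H N) ≤ lapDet (attach G' r' H N) ∧
      (lapDet (attach G r H N) = lapDet (attach G' r' H N) → lapMinor G r = lapMinor G' r') := by
  rw [lapDet_attach _ _ (restDet_ne_zero H N), lapDet_attach _ _ (restDet_ne_zero H N)]
  have h3 := mul_le_mul_of_nonneg_right h2 (restDet_nonneg H N)
  have h4 := mul_le_mul_of_nonneg_right h1 (restCoeff_nonneg H N)
  refine ⟨add_le_add h3 h4, fun h => ?_⟩
  exact mul_right_cancel₀ (restCoeff_ne_zero H N hN) ((add_eq_add_iff_eq_and_eq h3 h4).1 h).2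

theorem sum_legLength (S l : ℕ) (hl : 0 < l) :
    ∑ j : Fin l, (S / l + if (j : ℕ) < S % l then 1 else 0) = S := by
  rw [Fin.sum_univ_eq_sum_range (fun j => S / l + if j < S % l then 1 else 0),
    Finset.sum_add_distrib, Finset.sum_const, Finset.card_range, smul_eq_mul,
    ← Finset.card_filter]
  have : (Finset.range l).filter (· < S % l) = Finset.range (S % l) := by
    ext j
    have := Nat.mod_lt S hl
    simp only [Finset.mem_filter, Finset.mem_range]
    omega
  rw [this, Finset.card_range]
  exact Nat.div_add_mod S l

/-- The balanced starlike tree as a plane tree. -/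
theorem exists_balancedStarlike_iso {S l : ℕ} (hl : 0 < l) (hS : l ≤ S) :
    ∃ L : List ℕ, (∃ k, ∀ a ∈ L, a = k ∨ a = k + 1) ∧ L.length = l ∧ L.sum + L.length = S ∧
      ∃ e : (PlaneTree.starlike L).graph ≃g (balancedStarlike (S + 1) l).graph,
        e (PlaneTree.starlike L).root = (balancedStarlike (S + 1) l).root := by
  -- `starlike` stores each leg length minus one, so one edge per leg is removed beforehand; `l ≤ S`
  -- ensures that no leg is empty.
  obtain ⟨S, rfl⟩ := Nat.exists_eq_add_of_le' hS
  let f : Fin l → ℕ := fun j => S / l + if (j : ℕ) < S % l then 1 else 0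
  have hf : (fun j : Fin l => f j + 1) = fun j : Fin l => legLength (S + l + 1) l j := by
    funext j
    simp only [f, legLength, Nat.add_sub_cancel, Nat.add_div_right _ hl, Nat.add_mod_right]
    omega
  refine ⟨List.ofFn f, ⟨S / l, ?_⟩, by simp, ?_, ?_⟩
  · intro a ha
    obtain ⟨j, rfl⟩ := List.mem_ofFn.1 ha
    simp only [f]
    split_ifs <;> simp
  · rw [List.sum_ofFn, List.length_ofFn, sum_legLength S l hl]
  · have h : ∀ f', (fun j => f j + 1) = f' →
        ∃ e : (PlaneTree.starlike (List.ofFn f)).graph ≃g legsGraph f',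
          e (PlaneTree.starlike (List.ofFn f)).root = none := by
      rintro _ rfl
      exact exists_legsGraph_iso f
    obtain ⟨e, he⟩ := h _ hf
    let E : legsGraph (fun j : Fin l => legLength (S + l + 1) l j) ≃g
        (balancedStarlike (S + l + 1) l).graph :=
      ⟨Equiv.refl _, by rintro (_ | x) (_ | y) <;> exact Iff.rfl⟩
    exact ⟨e.trans E, he⟩

theorem corollary2p6 (n l g : ℕ) (hg : 3 ≤ g) (T : Fin g → RootedGraph.{u})
    (hT : ∀ i, (T i).graph.IsTree)
    (hU : IsUnicyclic n l g (cycleAttach T))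
    (hdeg : 3 < vertexDegree (cycleAttach T) ⟨⟨0, by omega⟩, (T ⟨0, by omega⟩).root⟩)
    (hsingle : ∀ i : Fin g, (i : ℕ) ≠ 0 → Fintype.card (T i).V = 1) :
    LaplacianLE (cycleAttach (balancedFamily n l g)) (cycleAttach T) ∧
      (LaplacianEq (cycleAttach (balancedFamily n l g)) (cycleAttach T) ↔
        Nonempty (cycleAttach (balancedFamily n l g) ≃g cycleAttach T)) := by
  set o : Fin g := ⟨0, by omega⟩ with ho
  obtain ⟨eT, heT⟩ := exists_cycleAttach_iso o T fun i hi =>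
    hsingle i fun h => hi (Fin.ext h)
  obtain ⟨t, φ, hφ⟩ := (hT o).exists_planeTree (T o).root
  -- Two of the more than three neighbors of the root lie on the cycle.
  have hchildren : 2 ≤ t.children := by
    rw [← heT, vertexDegree_iso, vertexDegree_attach_cycle hg, ← hφ, vertexDegree_iso,
      PlaneTree.vertexDegree_root] at hdeg
    omega
  have hl : l = t.leaves := by
    rw [← hU.leaves, ← leafCount_iso eT, leafCount_attach_cycle hg, ← hφ, nonrootLeaves_iso,
      PlaneTree.nonrootLeaves_graph]
  have hn : n = t.edges + g := by
    have h := Fintype.card_congr eT.toEquiv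
    rw [Fintype.card_sum, card_cycleRest, hU.order, ← Fintype.card_congr φ.toEquiv,
      PlaneTree.card_vert] at h
    omega
  have hlpos : 0 < l := hl ▸ PlaneTree.leaves_pos (by omega)
  have hle : l ≤ t.edges := hl ▸ t.branchLeaves_le.2
  obtain ⟨L, hbal, hlen, hsum, ψ, hψ⟩ := exists_balancedStarlike_iso hlpos hle
  have hBo : balancedFamily n l g o = balancedStarlike (t.edges + 1) l := by
    rw [balancedFamily, if_pos rfl, hn, Nat.add_sub_cancel]
  obtain ⟨eB, -⟩ := exists_cycleAttach_iso o (balancedFamily n l g) fun i hi => by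
    have : (i : ℕ) ≠ 0 := fun h => hi (Fin.ext h)
    rw [balancedFamily, if_neg this]
    rfl
  rw [hBo] at eB
  have eB' := (attachIso ψ SimpleGraph.Iso.refl hψ fun _ => Iff.rfl).trans eB
  have eT' := (attachIso φ SimpleGraph.Iso.refl hφ fun _ => Iff.rfl).trans eT
  obtain ⟨⟨hQ, hP⟩, hEq⟩ := PlaneTree.balanced_le intPolynomial_X_pos t hchildren hbal
    (hlen.trans hl) hsum
  rw [← (PlaneTree.lapMinor_lapDet_graph _).1, ← (PlaneTree.lapMinor_lapDet_graph _).1] at hQ hEq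
  rw [← (PlaneTree.lapMinor_lapDet_graph _).2, ← (PlaneTree.lapMinor_lapDet_graph _).2] at hP
  obtain ⟨hmain, hmainEq⟩ := lapDet_attach_le (H := cycleRest o) (exists_cycleNbr hg o) hQ hP
  have hLt : L.sum + L.length = (PlaneTree.starlike L).edges := by
    have : ∀ l : List ℕ, l.sum + l.length = (PlaneTree.starlike l).edges := by
      have hpath : ∀ a, (PlaneTree.path a).edges = a := by
        intro a
        induction a with
        | zero => rfl
        | succ a ih => rw [PlaneTree.path, PlaneTree.edges, ih]; rfl
      intro l
      induction l with
      | nil => rfl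
      | cons a l ih =>
        rw [PlaneTree.starlike, PlaneTree.edges, ← ih, hpath, List.sum_cons, List.length_cons]
        omega
    exact this L
  have hcard : Fintype.card (Σ i, (balancedFamily n l g i).V) = Fintype.card (Σ i, (T i).V) := by
    rw [← Fintype.card_congr eB'.toEquiv, ← Fintype.card_congr eT'.toEquiv, Fintype.card_sum,
      Fintype.card_sum, PlaneTree.card_vert, PlaneTree.card_vert, ← hLt, hsum]
  refine ⟨laplacianLE_of_lapDet_le hcard ?_, ⟨fun h => ?_, fun ⟨e⟩ => LaplacianEq.of_iso e⟩⟩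
  · rw [← lapDet_iso eB', ← lapDet_iso eT']
    exact hmain
  · have h' := h.lapDet_eq
    rw [← lapDet_iso eB', ← lapDet_iso eT'] at h'
    -- Equal Laplacian coefficients give equal minors at the root, which force the tree to be
    -- starlike with the same legs up to order.
    obtain ⟨L', rfl, hperm⟩ := hEq (hmainEq h')
    obtain ⟨χ, hχ⟩ := PlaneTree.exists_starlike_iso_of_perm hperm
    exact ⟨eB'.symm.trans ((attachIso χ SimpleGraph.Iso.refl hχ fun _ => Iff.rfl).trans eT')⟩
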